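/- **Setting.** Let $\Theta\subseteq\mathbb R^d$ be a closed set without isolated points, $p(\theta)$ a prior probability density on $\Theta$ (with respect to Lebesgue measure), and, for each $\theta$, $p(x\mid\theta)$ a density of a single observation $x\in\mathbb R^m$ with respect to a $\sigma$-finite reference measure $\nu$ (Lebesgue measure for a PDF); densities are extended by zero. Put $p(x,\theta)=p(x\mid\theta)p(\theta)$. Write $\theta\to\partial\Theta^+$ for convergence, within $\Theta$, of $\theta$ to a boundary point of $\Theta$ (through points different from it) or to infinity if $\Theta$ is unbounded. $E$ denotes expectation under $p(x,\theta)$. For $N\ge 1$ let $F_B=F_B(N)=E\big[\nabla_\theta\log p(X_1,\dots,X_N,\theta)\,\nabla_\theta\log p(X_1,\dots,X_N,\theta)^T\big]$ be the Bayesian Fisher information matrix of $N$ observations that are i.i.d. given $\theta$, where $p(x_1,\dots,x_N,\theta)=p(\theta)\prod_i p(x_i\mid\theta)$. The Bayesian Cramér–Rao bound is $F_B^{-1}$. **Assumptions.** 1. *(BCRB regularity, for a single observation.)* The gradients $\nabla_\theta\log p(x,\theta)$ and $\nabla_\theta\log p(\theta)$ exist at interior points of $\Theta$ where the densities are positive;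 $\nabla_\theta\log p(x,\theta)$ is absolutely integrable under the joint law; $E[\nabla_\theta\log p(X,\theta)\nabla_\theta\log p(X,\theta)^T]$ is finite and positive definite; $\theta\,p(x,\theta)\to0$ as $\theta\to\partial\Theta^+$ for every $x$; $\int p(x,\theta)\nabla_\theta\log p(x,\theta)\,d\theta=0$ for every $x$; the set $\{x:p(x,\theta)>0\}$ is the same for all $\theta$ in the interior of $\Theta$. 2. *(Networks.)* $s_P(\theta;\Omega)$, $\Omega\in\mathcal S_P$, and $s_F(x\mid\theta;\Omega)$, $\Omega\in\mathcal S_F$, are families of $\mathbb R^d$-valued functions, measurable in the data, with compact parameter sets $\mathcal S_P,\mathcal S_F$ in Euclidean spaces. 3. *(Score matching regularity.)* $\log p(\theta)$ and $\log p(x\mid\theta)$, as well as all $s_P(\cdot;\Omega)$, $s_F(x\mid\cdot\,;\Omega)$, are differentiable in $\theta$ at interior points of $\Theta$ where $p(\theta)>0$, respectively $p(x,\theta)>0$; the expectations of $\|\nabla_\theta\log p(\theta)\|^2$, $\|\nabla_\theta\log p(X\mid\theta)\|^2$, $\|s_P(\theta;\Omega)\|^2$, $\|s_F(X\mid\theta;\Omega)\|^2$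 are finite; and, for all $\Omega$ and $x$, the boundary conditions $s_P(\theta;\Omega)p(\theta)\to0$ and $s_F(x\mid\theta;\Omega)p(x,\theta)\to0$ as $\theta\to\partial\Theta^+$ hold. 4. *(Lipschitz continuity in the network parameter.)* For $(f,z)=(s_P,\theta)$ and for $(f,z)=(s_F,(\theta,x))$ there are functions $\xi,\tau,\zeta$ with $E\,\xi(Z)^2,\,E\,\tau(Z),\,E\,\zeta(Z)<\infty$ such that for almost every $z$ and all admissible $\Omega_1,\Omega_2$: $\|f(z;\Omega_1)-f(z;\Omega_2)\|_2\le\xi(z)\|\Omega_1-\Omega_2\|_2$, $\;\|\partial_\theta f(z;\Omega_1)-\partial_\theta f(z;\Omega_2)\|_2\le\tau(z)\|\Omega_1-\Omega_2\|_2$, and $\|f(z;\Omega_1)f(z;\Omega_1)^T-f(z;\Omega_2)f(z;\Omega_2)^T\|_F\le\zeta(z)\|\Omega_1-\Omega_2\|_2$. 5. *(Realizability.)* There are $\Omega_P^0\in\mathcal S_P$ and $\Omega_F^0\in\mathcal S_F$ with $s_P(\theta;\Omega_P^0)=\nabla_\theta\log p(\theta)$ and $s_F(x\mid\theta;\Omega_F^0)=\nabla_\theta\log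 p(x\mid\theta)$ at interior points of $\Theta$ where $p(\theta)>0$, respectively $p(x,\theta)>0$. 6. *(Data and training.)* Let $J\ge1$. The data $(\theta_k,(X_{k,j})_{j=1}^{J})$, $k=1,2,\dots$, are i.i.d. in $k$, with $\theta_k\sim p(\theta)$ and $X_{k,1},\dots,X_{k,J}$ i.i.d. $\sim p(x\mid\theta_k)$ given $\theta_k$. Almost surely, for each $n\ge1$, $\Omega_P^*=\Omega_P^*(n)$ is a global minimizer over $\mathcal S_P$ of $$\frac1n\sum_{k=1}^n\Big(\|s_P(\theta_k;\Omega)\|_2^2+2\,\mathrm{tr}\,\partial_\theta s_P(\theta_k;\Omega)\Big),$$ and $\Omega_F^*=\Omega_F^*(n)$ is a global minimizer over $\mathcal S_F$ of $$\frac1{nJ}\sum_{k=1}^n\sum_{j=1}^J\Big(\|s_F(X_{k,j}\mid\theta_k;\Omega)\|_2^2+2\,s_F(X_{k,j}\mid\theta_k;\Omega)^Ts_P(\theta_k;\Omega_P^*)+2\,\mathrm{tr}\,\partial_\theta s_F(X_{k,j}\mid\theta_k;\Omega)\Big).$$ 7. *(Bounds.)* There are (data-dependent) $c_M(n),c_P(n)$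 such that, almost surely, for all $n$ and $k\le n$, $\big\|\frac1J\sum_j s_F(X_{k,j}\mid\theta_k;\Omega_F^*)s_F(X_{k,j}\mid\theta_k;\Omega_F^*)^T\big\|_2\le c_M(n)$ and $\|s_P(\theta_k;\Omega_P^*)\|_2^2\le c_P(n)$, and $c_M(n)/n\to0$, $c_P(n)/n\to0$ almost surely. **Conclusion.** Let $$\hat F_M=\frac1{nJ}\sum_{k=1}^n\sum_{j=1}^J s_F(X_{k,j}\mid\theta_k;\Omega_F^*)s_F(X_{k,j}\mid\theta_k;\Omega_F^*)^T,\qquad \hat F_P=\frac1n\sum_{k=1}^n s_P(\theta_k;\Omega_P^*)s_P(\theta_k;\Omega_P^*)^T .$$ Then, for every $N\ge1$, $F_B$ is finite and positive definite, and almost surely $N\hat F_M+\hat F_P$ is positive definite for all sufficiently large $n$ and $$\big(N\hat F_M+\hat F_P\big)^{-1}\longrightarrow F_B^{-1}\qquad(n\to\infty).$$ That is, the learned BCRB is a strongly consistent estimate of the BCRB. -/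

import Mathlib

open MeasureTheory ProbabilityTheory Filter Topology

noncomputable section

namespace LBCRB

/-- `E d` is `ℝ^d` with the Euclidean norm. -/
abbrev E (d : ℕ) : Type := EuclideanSpace ℝ (Fin d)

/-- A Bayesian statistical model: a closed parameter set without isolated points, a prior density
`prior θ` with respect to Lebesgue measure, vanishing off the parameter set, and for each parameter
`θ` a density `lik x θ` of a single observation `x` with respect to a reference measure `ν`
(Lebesgue measure for a PDF, counting measure on the alphabet for a PMF). Densities are extended by
zero outside the observation set. -/
structure Model (d m : ℕ) where
  paramSet : Set (E d)
  paramSet_perfect : Perfect paramSet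
  ν : Measure (E m)
  ν_sigmaFinite : SigmaFinite ν
  prior : E d → ℝ
  prior_measurable : Measurable prior
  prior_nonneg : ∀ θ, 0 ≤ prior θ
  prior_eq_zero : ∀ θ, θ ∉ paramSet → prior θ = 0
  lintegral_prior : ∫⁻ θ, ENNReal.ofReal (prior θ) = 1
  lik : E m → E d → ℝ
  lik_measurable : Measurable (fun z : E d × E m => lik z.2 z.1)
  lik_nonneg : ∀ x θ, 0 ≤ lik x θ
  lintegral_lik : ∀ θ, 0 < prior θ → ∫⁻ x, ENNReal.ofReal (lik x θ) ∂ν = 1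

variable {d m kP kF : ℕ}

namespace Model

/-- Joint density of the parameter and a single observation. -/
def joint (P : Model d m) (x : E m) (θ : E d) : ℝ := P.lik x θ * P.prior θ

/-- Joint density of the parameter and `N` observations, i.i.d. given the parameter. -/
def setJoint (P : Model d m) (N : ℕ) (x : Fin N → E m) (θ : E d) : ℝ :=
  P.prior θ * ∏ i, P.lik (x i) θ

/-- Law of the parameter. -/
def priorLaw (P : Model d m) : Measure (E d) :=
  (volume : Measure (E d)).withDensity fun θ => ENNReal.ofReal (P.prior θ)

/-- Joint law of the parameter and a single observation. -/
def jointLaw (P : Model d m) : Measure (E d × E m) :=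
  ((volume : Measure (E d)).prod P.ν).withDensity fun z => ENNReal.ofReal (P.joint z.2 z.1)

/-- Joint law of the parameter and `N` observations, i.i.d. given the parameter. -/
def setLaw (P : Model d m) (N : ℕ) : Measure (E d × (Fin N → E m)) :=
  ((volume : Measure (E d)).prod (Measure.pi fun _ : Fin N => P.ν)).withDensity
    fun z => ENNReal.ofReal (P.setJoint N z.2 z.1)

/-- The prior score `∇_θ log p(θ)`. -/
def priorScore (P : Model d m) (θ : E d) : E d :=
  gradient (fun t => Real.log (P.prior t)) θ

/-- The Fisher (measurement) score `∇_θ log p(x | θ)` of a single observation. -/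
def fisherScore (P : Model d m) (x : E m) (θ : E d) : E d :=
  gradient (fun t => Real.log (P.lik x t)) θ

/-- The score `∇_θ log p(x, θ)` of the joint density of a single observation. -/
def jointScore (P : Model d m) (x : E m) (θ : E d) : E d :=
  gradient (fun t => Real.log (P.joint x t)) θ

/-- The score `∇_θ log p(x₁, …, x_N, θ)` of the joint density of `N` observations. -/
def bayesScore (P : Model d m) (N : ℕ) (x : Fin N → E m) (θ : E d) : E d :=
  gradient (fun t => Real.log (P.setJoint N x t)) θ

end Model

/-- The matrix `v vᵀ`. -/
def outer (v : E d) : Matrix (Fin d) (Fin d) ℝ := Matrix.of fun i j => v i * v j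

/-- Trace of the Jacobian of `s` at `θ`. -/
def traceJacobian (s : E d → E d) (θ : E d) : ℝ :=
  ∑ i, fderiv ℝ s θ (EuclideanSpace.single i 1) i

/-- Spectral norm of a matrix. -/
def specNorm (A : Matrix (Fin d) (Fin d) ℝ) : ℝ := ‖Matrix.toEuclideanCLM (𝕜 := ℝ) A‖

/-- Frobenius norm of a matrix. -/
def frobNorm (A : Matrix (Fin d) (Fin d) ℝ) : ℝ := √(∑ i, ∑ j, A i j ^ 2)

namespace Model

/-- Second moment matrix of the score of the joint density of a single observation. -/
def singleFIM (P : Model d m) : Matrix (Fin d) (Fin d) ℝ :=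
  Matrix.of fun i j => ∫ z, outer (P.jointScore z.2 z.1) i j ∂P.jointLaw

/-- The Bayesian Fisher information matrix `F_B` of `N` observations. -/
def bayesFIM (P : Model d m) (N : ℕ) : Matrix (Fin d) (Fin d) ℝ :=
  Matrix.of fun i j => ∫ z, outer (P.bayesScore N z.2 z.1) i j ∂P.setLaw N

end Model

/-- `g(θ) → 0` as `θ`, staying in `Θ`, tends to a point of the boundary of `Θ`, or to infinity
(the latter is void when `Θ` is bounded). -/
def TendsToZeroAtBoundary (Θ : Set (E d)) (g : E d → E d) : Prop :=
  (∀ θ₀ ∈ frontier Θ, Tendsto g (𝓝[Θ \ {θ₀}] θ₀) (𝓝 0)) ∧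
    Tendsto g (Bornology.cobounded (E d) ⊓ 𝓟 Θ) (𝓝 0)

/-- Regularity conditions of the Bayesian Cramér-Rao bound, for a single observation. Gradients
with respect to the parameter are required at interior points of the parameter set. -/
structure BCRBRegular (P : Model d m) : Prop where
  joint_differentiable : ∀ x, ∀ θ ∈ interior P.paramSet, 0 < P.joint x θ →
    DifferentiableAt ℝ (fun t => Real.log (P.joint x t)) θ
  jointScore_integrable : Integrable (fun z => P.jointScore z.2 z.1) P.jointLaw
  prior_differentiable : ∀ θ ∈ interior P.paramSet, 0 < P.prior θ →
    DifferentiableAt ℝ (fun t => Real.log (P.prior t)) θ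
  jointScore_sq_integrable : Integrable (fun z => ‖P.jointScore z.2 z.1‖ ^ 2) P.jointLaw
  singleFIM_posDef : P.singleFIM.PosDef
  boundary : ∀ x, TendsToZeroAtBoundary P.paramSet (fun θ => P.joint x θ • θ)
  condScore_eq_zero : ∀ x, ∫ θ, P.joint x θ • P.jointScore x θ = 0
  common_support : ∃ A : Set (E m), ∀ θ ∈ interior P.paramSet, {x | 0 < P.joint x θ} = A

/-- Regularity conditions and boundary condition of score matching, for the prior score network
`s Ω θ` with parameter `Ω` in `S`. -/
structure PriorMatchingRegular (P : Model d m) (S : Set (E kP)) (s : E kP → E d → E d) :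
    Prop where
  prior_differentiable : ∀ θ ∈ interior P.paramSet, 0 < P.prior θ →
    DifferentiableAt ℝ (fun t => Real.log (P.prior t)) θ
  net_measurable : ∀ Ω ∈ S, Measurable (s Ω)
  net_differentiable : ∀ Ω ∈ S, ∀ θ ∈ interior P.paramSet, 0 < P.prior θ →
    DifferentiableAt ℝ (s Ω) θ
  net_sq_integrable : ∀ Ω ∈ S, Integrable (fun θ => ‖s Ω θ‖ ^ 2) P.priorLaw
  score_sq_integrable : Integrable (fun θ => ‖P.priorScore θ‖ ^ 2) P.priorLaw
  boundary : ∀ Ω ∈ S, TendsToZeroAtBoundary P.paramSet (fun θ => P.prior θ • s Ω θ)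

/-- Regularity conditions and boundary condition of Fisher score matching, for the Fisher score
network `s Ω x θ` of a single observation with parameter `Ω` in `S`. -/
structure FisherMatchingRegular (P : Model d m) (S : Set (E kF)) (s : E kF → E m → E d → E d) :
    Prop where
  lik_differentiable : ∀ x, ∀ θ ∈ interior P.paramSet, 0 < P.joint x θ →
    DifferentiableAt ℝ (fun t => Real.log (P.lik x t)) θ
  net_measurable : ∀ Ω ∈ S, Measurable (fun z : E d × E m => s Ω z.2 z.1)
  net_differentiable : ∀ Ω ∈ S, ∀ x, ∀ θ ∈ interior P.paramSet, 0 < P.joint x θ →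
    DifferentiableAt ℝ (s Ω x) θ
  net_sq_integrable : ∀ Ω ∈ S, Integrable (fun z => ‖s Ω z.2 z.1‖ ^ 2) P.jointLaw
  score_sq_integrable : Integrable (fun z => ‖P.fisherScore z.2 z.1‖ ^ 2) P.jointLaw
  boundary : ∀ Ω ∈ S, ∀ x, TendsToZeroAtBoundary P.paramSet (fun θ => P.joint x θ • s Ω x θ)

/-- The true prior score is one of the functions represented by the prior network. -/
def PriorRealizable (P : Model d m) (S : Set (E kP)) (s : E kP → E d → E d) : Prop :=
  ∃ Ω ∈ S, ∀ θ ∈ interior P.paramSet, 0 < P.prior θ → s Ω θ = P.priorScore θ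

/-- The true Fisher score is one of the functions represented by the Fisher network. -/
def FisherRealizable (P : Model d m) (S : Set (E kF)) (s : E kF → E m → E d → E d) : Prop :=
  ∃ Ω ∈ S, ∀ x, ∀ θ ∈ interior P.paramSet, 0 < P.joint x θ → s Ω x θ = P.fisherScore x θ

/-- Lipschitz continuity in the network parameter `Ω ∈ S` of a network `f Ω z`, of its Jacobian
`J Ω z` with respect to `θ`, and of `f fᵀ`, where the Lipschitz constants `ξ`, `τ`, `ζ` depend on
the data `z` and satisfy `E ξ² < ∞`, `E τ < ∞`, `E ζ < ∞` under the law of `z`. -/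
def LipschitzInParam {k : ℕ} {Z : Type*} [MeasurableSpace Z] (law : Measure Z) (S : Set (E k))
    (f : E k → Z → E d) (J : E k → Z → E d →L[ℝ] E d) : Prop :=
  ∃ ξ τ ζ : Z → ℝ, Integrable (fun z => ξ z ^ 2) law ∧ Integrable τ law ∧ Integrable ζ law ∧
    ∀ᵐ z ∂law, ∀ Ω₁ ∈ S, ∀ Ω₂ ∈ S,
      ‖f Ω₁ z - f Ω₂ z‖ ≤ ξ z * ‖Ω₁ - Ω₂‖ ∧
      ‖J Ω₁ z - J Ω₂ z‖ ≤ τ z * ‖Ω₁ - Ω₂‖ ∧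
      frobNorm (outer (f Ω₁ z) - outer (f Ω₂ z)) ≤ ζ z * ‖Ω₁ - Ω₂‖

/-- The random data: pairs `(θ n, (X n 0, …, X n (J - 1)))`, independent and identically
distributed in `n`, where `θ n` follows the prior and `X n 0, …, X n (J - 1)` are, given `θ n`,
i.i.d. with density `lik · (θ n)`. -/
structure IsData {Ωs : Type*} [MeasurableSpace Ωs] (μ : Measure Ωs) (P : Model d m) (J : ℕ)
    (θ : ℕ → Ωs → E d) (X : ℕ → Fin J → Ωs → E m) : Prop where
  measurable_θ : ∀ n, Measurable (θ n)
  measurable_X : ∀ n j, Measurable (X n j)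
  indep : iIndepFun (fun n ω => (θ n ω, fun j => X n j ω)) μ
  law : ∀ n, μ.map (fun ω => (θ n ω, fun j => X n j ω)) = P.setLaw J

/-- Empirical score matching objective of the prior network, on the first `n` data points. -/
def priorLoss (s : E kP → E d → E d) (n : ℕ) (θ : ℕ → E d) (Ω : E kP) : ℝ :=
  (1 / (n : ℝ)) * ∑ k ∈ Finset.range n, (‖s Ω (θ k)‖ ^ 2 + 2 * traceJacobian (s Ω) (θ k))

/-- Empirical Fisher score matching objective of the Fisher network, on the first `n` data points,
where `sP` is the prior score function in use. -/
def fisherLoss {J : ℕ} (s : E kF → E m → E d → E d) (sP : E d → E d) (n : ℕ) (θ : ℕ → E d)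
    (x : ℕ → Fin J → E m) (Ω : E kF) : ℝ :=
  (1 / ((n : ℝ) * J)) * ∑ k ∈ Finset.range n, ∑ j : Fin J,
    (‖s Ω (x k j) (θ k)‖ ^ 2 + 2 * inner ℝ (s Ω (x k j) (θ k)) (sP (θ k))
      + 2 * traceJacobian (s Ω (x k j)) (θ k))

/-- Empirical second moment of the prior score function `s` (the matrix `F̂_P`). -/
def learnedPriorFIM (s : E d → E d) (n : ℕ) (θ : ℕ → E d) : Matrix (Fin d) (Fin d) ℝ :=
  (1 / (n : ℝ)) • ∑ k ∈ Finset.range n, outer (s (θ k))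

/-- Empirical second moment of the Fisher score function `s` (the matrix `F̂_M`). -/
def learnedMeasurementFIM {J : ℕ} (s : E m → E d → E d) (n : ℕ) (θ : ℕ → E d)
    (x : ℕ → Fin J → E m) : Matrix (Fin d) (Fin d) ℝ :=
  (1 / ((n : ℝ) * J)) • ∑ k ∈ Finset.range n, ∑ j : Fin J, outer (s (x k j) (θ k))

/-- The learned Bayesian Fisher information matrix `N F̂_M + F̂_P` for `N` observations. -/
def learnedFIM {J : ℕ} (N : ℕ) (sP : E d → E d) (sF : E m → E d → E d) (n : ℕ) (θ : ℕ → E d)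
    (x : ℕ → Fin J → E m) : Matrix (Fin d) (Fin d) ℝ :=
  (N : ℝ) • learnedMeasurementFIM sF n θ x + learnedPriorFIM sP n θ

end LBCRB

end

/-!
The minimizers of the empirical score matching objectives converge in mean square to the true
scores, so the empirical second moments of the learned scores converge to the true ones, and the
Bayesian information of `N` observations is the corresponding combination of second moments.

*Support.* The joint density tends to `0` (up to the factor `θ`) at every boundary point of the
parameter set `Θ`, so it is nonzero only on a null part of the boundary, and the prior lives on the
interior of `Θ`. The support of the joint density does not depend on the parameter, so the prior
is positive on the whole interior (`Model.prior_pos`), and each observation is possible for all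
interior parameters or for none. Hence the densities are differentiable on all of the interior.

*Integration by parts.* A function that is differentiable on the interior of `Θ` and vanishes at the
boundary and at infinity has directional derivatives of integral zero, as soon as these are
integrable (`integral_fderiv_eq_zero_of_vanishesAtBoundary`). The boundary may be arbitrary:
truncating the *values* of the function near zero makes it compactly supported in the interior, and
the truncation is removed by dominated convergence, since the derivative vanishes almost everywhere
on the zero set. This gives Stein's identity for the prior and for the joint law.

*Information.* Stein's identity with test functions of the parameter shows that the Fisher score has
conditional mean zero given the parameter (`Model.ae_integral_lik_mul_fisherScore_eq_zero`). Hence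
the scores of the prior and of the observations are uncorrelated, and the Bayesian information is
`N F_M + F_P` (`Model.bayesFIM_eq`), which is positive definite because `F_M + F_P` is.

*Consistency.* By Stein's identity the expected excess of the prior objective over its value at the
true score is the mean square distance to the true score (`Model.integral_priorExcess`); for the
Fisher objective this holds up to the error of the learned prior score
(`Model.le_integral_fisherExcess`). Only excesses are considered, since the Jacobian of the true
score itself need not be integrable. A uniform law of large numbers over the compact parameter sets
(`tendsto_empiricalMean_uniform`) then gives the mean square convergence of the learned scores and
the convergence of the empirical second moments.
-/

noncomputable section

namespace LBCRB

variable {d m kP kF : ℕ}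

/-! ### Integration by parts on an open set without boundary regularity -/

/-- The level set of a differentiable function on which the derivative does not vanish is null: at
a density point of the level set the function is flat in every direction. -/
lemma ae_fderiv_eq_zero_of_eq_zero {w : E d → ℝ} {w' : E d → E d →L[ℝ] ℝ} {s : Set (E d)}
    (hs : MeasurableSet s) (hw : ∀ x ∈ s, HasFDerivAt w (w' x) x) (h0 : ∀ x ∈ s, w x = 0) :
    ∀ᵐ x, x ∈ s → w' x = 0 := by
  rw [← ae_restrict_iff' hs]
  by_cases hd : ∃ e : E d, e ≠ 0
  · obtain ⟨e, he⟩ := hd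
    have key : ApproximatesLinearOn (fun x => w x • e) (0 : E d →L[ℝ] E d) s 0 := by
      intro x hx y hy
      simp [h0 x hx, h0 y hy]
    have := key.norm_fderiv_sub_le (volume : Measure (E d)) hs (fun x => (w' x).smulRight e)
      (fun x hx => ((hw x hx).smul_const e).hasFDerivWithinAt)
    filter_upwards [this] with x hx
    have h1 : (w' x).smulRight e = 0 := by
      rw [sub_zero] at hx
      exact nnnorm_eq_zero.1 (le_antisymm hx bot_le)
    ext v
    have h2 := congrArg (fun L : E d →L[ℝ] E d => L v) h1
    simpa [he] using h2
  · push Not at hd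
    refine ae_of_all _ fun x => ?_
    ext v
    simp [hd v]

/-- A `C¹` function that vanishes on `[-1, 1]`, and has bounded derivative which is `1` away from
a compact set. -/
lemma exists_truncation : ∃ φ : ℝ → ℝ, ContDiff ℝ 1 φ ∧ (∀ y, |y| ≤ 1 → φ y = 0) ∧
    (∀ y, 2 < |y| → deriv φ y = 1) ∧ ∃ C, ∀ y, |deriv φ y| ≤ C := by
  let χ : ContDiffBump (0 : ℝ) := ⟨1, 2, by norm_num, by norm_num⟩
  have hχ : ContDiff ℝ 1 χ := χ.contDiff
  have hφ : ContDiff ℝ 1 (fun y : ℝ => y * (1 - χ y)) :=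
    contDiff_id.mul (contDiff_const.sub hχ)
  have hone : ∀ y : ℝ, 2 < |y| → deriv (fun y : ℝ => y * (1 - χ y)) y = 1 := by
    intro y hy
    have : (fun y : ℝ => y * (1 - χ y)) =ᶠ[𝓝 y] fun y => y := by
      filter_upwards [(isOpen_lt continuous_const continuous_abs).mem_nhds hy] with z hz
      have : χ z = 0 := χ.zero_of_le_dist (by simpa [Real.dist_eq] using (le_of_lt hz))
      simp [this]
    rw [this.deriv_eq]; simp
  refine ⟨fun y => y * (1 - χ y), hφ, ?_, hone, ?_⟩
  · intro y hy
    have : χ y = 1 := χ.one_of_mem_closedBall (by simpa using hy)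
    simp [this]
  · have hc : Continuous (deriv fun y : ℝ => y * (1 - χ y)) := hφ.continuous_deriv le_rfl
    obtain ⟨C, hC⟩ := (isCompact_Icc (a := (-2 : ℝ)) (b := 2)).exists_bound_of_continuousOn
      hc.continuousOn
    refine ⟨max C 1, fun y => ?_⟩
    by_cases hy : |y| ≤ 2
    · exact (hC y (abs_le.1 hy)).trans (le_max_left _ _)
    · rw [hone y (not_le.1 hy)]; simp

/-- `g(θ) → 0` as `θ`, staying in `Θ`, tends to a boundary point of `Θ` or to infinity, for a
scalar function `g`. -/
def VanishesAtBoundary (Θ : Set (E d)) (g : E d → ℝ) : Prop :=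
  (∀ θ₀ ∈ frontier Θ, Tendsto g (𝓝[Θ \ {θ₀}] θ₀) (𝓝 0)) ∧
    Tendsto g (Bornology.cobounded (E d) ⊓ 𝓟 Θ) (𝓝 0)

lemma TendsToZeroAtBoundary.coord {Θ : Set (E d)} {g : E d → E d}
    (h : TendsToZeroAtBoundary Θ g) (a : Fin d) : VanishesAtBoundary Θ (fun θ => g θ a) := by
  have hc : Tendsto (fun v : E d => v a) (𝓝 0) (𝓝 0) := by
    have : Continuous fun v : E d => v a := by fun_prop
    simpa using this.tendsto (0 : E d)
  exact ⟨fun θ₀ h0 => hc.comp (h.1 θ₀ h0), hc.comp h.2⟩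

lemma VanishesAtBoundary.sub {Θ : Set (E d)} {f g : E d → ℝ}
    (hf : VanishesAtBoundary Θ f) (hg : VanishesAtBoundary Θ g) :
    VanishesAtBoundary Θ (fun θ => f θ - g θ) :=
  ⟨fun θ₀ h0 => by simpa using (hf.1 θ₀ h0).sub (hg.1 θ₀ h0), by simpa using hf.2.sub hg.2⟩

/-- The divergence theorem behind score matching: a function on the interior of a closed set that
vanishes at the boundary and at infinity has directional derivatives of integral zero, as soon as
they are integrable. No regularity of the boundary is needed: truncating the values of the function
near `0` makes it compactly supported in the interior. -/
theorem integral_fderiv_eq_zero_of_vanishesAtBoundary {Θ : Set (E d)} (hΘ : IsClosed Θ)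
    {w : E d → ℝ} {w' : E d → E d →L[ℝ] ℝ} (hw : ∀ θ ∈ interior Θ, HasFDerivAt w (w' θ) θ)
    (hb : VanishesAtBoundary Θ w) (v : E d)
    (hint : IntegrableOn (fun θ => w' θ v) (interior Θ)) :
    ∫ θ in interior Θ, w' θ v = 0 := by
  classical
  set U := interior Θ with hU
  have hUo : IsOpen U := isOpen_interior
  have hUm : MeasurableSet U := hUo.measurableSet
  obtain ⟨φ, hφ, hφ0, hφ1, C, hC⟩ := exists_truncation
  -- extension of `w` by zero
  let W : E d → ℝ := U.indicator w
  have hWU : ∀ θ ∈ U, W =ᶠ[𝓝 θ] w := fun θ hθ => by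
    filter_upwards [hUo.mem_nhds hθ] with z hz
    exact Set.indicator_of_mem hz _
  have hWcont : Continuous W := by
    rw [continuous_iff_continuousAt]
    intro θ
    by_cases hθ : θ ∈ U
    · exact (hw θ hθ).continuousAt.congr (hWU θ hθ).symm
    have hWθ : W θ = 0 := Set.indicator_of_notMem hθ _
    by_cases hθ' : θ ∈ Θ
    · have hfr : θ ∈ frontier Θ := ⟨subset_closure hθ', hθ⟩
      have h1 := hb.1 θ hfr
      rw [ContinuousAt, hWθ]
      rw [Metric.tendsto_nhds] at h1 ⊢
      intro ε hε
      have h2 := eventually_nhdsWithin_iff.1 (h1 ε hε)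
      filter_upwards [h2] with z hz
      by_cases hzU : z ∈ U
      · have : W z = w z := Set.indicator_of_mem hzU _
        rw [this]
        refine hz ⟨interior_subset hzU, ?_⟩
        rintro rfl; exact hθ hzU
      · have : W z = 0 := Set.indicator_of_notMem hzU _
        simpa [this] using hε
    · have : W =ᶠ[𝓝 θ] fun _ => 0 := by
        filter_upwards [hΘ.isOpen_compl.mem_nhds hθ'] with z hz
        exact Set.indicator_of_notMem (fun h => hz (interior_subset h)) _
      exact continuousAt_const.congr this.symm
  have hWinf : ∀ ε > 0, ∃ R, ∀ θ : E d, R < ‖θ‖ → |W θ| < ε := by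
    intro ε hε
    have h1 := (Metric.tendsto_nhds.1 hb.2) ε hε
    rw [eventually_inf_principal] at h1
    rw [← comap_norm_atTop, eventually_comap] at h1
    obtain ⟨R, hR⟩ := eventually_atTop.1 h1
    refine ⟨R, fun θ hθ => ?_⟩
    by_cases hzU : θ ∈ U
    · have : W θ = w θ := Set.indicator_of_mem hzU _
      rw [this]
      simpa using hR _ hθ.le θ rfl (interior_subset hzU)
    · have : W θ = 0 := Set.indicator_of_notMem hzU _
      simpa [this] using hε
  -- the truncations integrate to zero
  have htr : ∀ ε > 0, ∫ θ in U, deriv φ (W θ / ε) * w' θ v = 0 := by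
    intro ε hε
    let G : E d → ℝ := fun θ => ε * φ (W θ / ε)
    let G' : E d → E d →L[ℝ] ℝ := fun θ => if θ ∈ U then deriv φ (W θ / ε) • w' θ else 0
    have hGcont : Continuous G := by
      have := hφ.continuous
      fun_prop
    have hGder : ∀ θ, HasFDerivAt G (G' θ) θ := by
      intro θ
      by_cases hθ : θ ∈ U
      · have h1 : HasFDerivAt W (w' θ) θ := (hw θ hθ).congr_of_eventuallyEq (hWU θ hθ)
        have h2 : HasFDerivAt (fun θ => W θ / ε) (ε⁻¹ • w' θ) θ := by
          simpa [div_eq_inv_mul] using h1.const_mul ε⁻¹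
        have h3 := ((hφ.differentiable one_ne_zero
          (W θ / ε)).hasDerivAt.comp_hasFDerivAt θ h2).const_mul ε
        refine h3.congr_fderiv ?_
        simp only [G', hθ, if_true]
        rw [smul_comm (deriv φ _), smul_smul, mul_inv_cancel₀ hε.ne', one_smul]
      · have hWθ : W θ = 0 := Set.indicator_of_notMem hθ _
        have : G =ᶠ[𝓝 θ] fun _ => 0 := by
          have h1 : ∀ᶠ z in 𝓝 θ, |W z| < ε := by
            have := hWcont.abs.tendsto θ
            rw [hWθ, abs_zero] at this
            exact this.eventually (gt_mem_nhds hε)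
          filter_upwards [h1] with z hz
          have : φ (W z / ε) = 0 := by
            apply hφ0
            rw [abs_div, abs_of_pos hε, div_le_one hε]; exact hz.le
          simp [G, this]
        have h2 : G' θ = 0 := by simp [G', hθ]
        rw [h2]
        exact (hasFDerivAt_const _ _).congr_of_eventuallyEq this
    have hGsupp : HasCompactSupport G := by
      obtain ⟨R, hR⟩ := hWinf ε hε
      refine HasCompactSupport.intro (isCompact_closedBall (0 : E d) R) fun θ hθ => ?_
      have h1 : |W θ| < ε := hR θ (by simpa using hθ)
      have : φ (W θ / ε) = 0 := by
        apply hφ0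
        rw [abs_div, abs_of_pos hε, div_le_one hε]; exact h1.le
      simp [G, this]
    have hG'v : (fun θ => G' θ v) = U.indicator (fun θ => deriv φ (W θ / ε) * w' θ v) := by
      ext θ
      by_cases hθ : θ ∈ U <;> simp [G', hθ]
    have hφ'c : Continuous (deriv φ) := hφ.continuous_deriv le_rfl
    have hG'int : Integrable (fun θ => G' θ v) := by
      rw [hG'v, integrable_indicator_iff hUm]
      refine Integrable.bdd_mul hint ?_ (c := C) ?_
      · exact (hφ'c.comp (hWcont.div_const ε)).aestronglyMeasurable
      · exact ae_of_all _ fun θ => hC _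
    have key := integral_bilinear_hasFDerivAt_right_eq_neg_left_of_integrable
      (μ := (volume : Measure (E d))) (f := fun _ : E d => (1 : ℝ)) (f' := fun _ => 0)
      (g := G) (g' := G') (v := v) (B := ContinuousLinearMap.mul ℝ ℝ)
      (by simp) (by simpa using hG'int)
      (by simpa using hGcont.integrable_of_hasCompactSupport hGsupp)
      (fun x _ => hasFDerivAt_const _ _) (fun x _ => hGder x)
    simp only [ContinuousLinearMap.mul_apply', one_mul, _root_.zero_apply, zero_mul,
      integral_zero, neg_zero] at key
    rw [hG'v, integral_indicator hUm] at key
    exact key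
  -- removing the truncation
  have hnull : ∀ᵐ θ ∂volume.restrict U, W θ = 0 → w' θ = 0 := by
    have h1 := ae_fderiv_eq_zero_of_eq_zero (w := w) (w' := w') (s := U ∩ {θ | W θ = 0})
      (hUm.inter (hWcont.measurable (measurableSet_singleton 0))) (fun x hx => hw x hx.1)
      (fun x hx => by
        have : W x = w x := Set.indicator_of_mem hx.1 _
        rw [← this]; exact hx.2)
    rw [ae_restrict_iff' hUm]
    filter_upwards [h1] with θ hθ hU h0 using hθ ⟨hU, h0⟩
  have hlim : Tendsto (fun n : ℕ => ∫ θ in U, deriv φ (W θ / (1 / ((n : ℝ) + 1))) * w' θ v) atTop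
      (𝓝 (∫ θ in U, w' θ v)) := by
    refine tendsto_integral_of_dominated_convergence (fun θ => C * ‖w' θ v‖) ?_
      (hint.norm.const_mul C) ?_ ?_
    · intro n
      have hφ'c : Continuous (deriv φ) := hφ.continuous_deriv le_rfl
      exact ((hφ'c.comp (hWcont.div_const _)).aestronglyMeasurable).mul hint.aestronglyMeasurable
    · intro n
      refine ae_of_all _ fun θ => ?_
      rw [norm_mul]
      exact mul_le_mul_of_nonneg_right (hC _) (norm_nonneg _)
    · filter_upwards [hnull] with θ hθ
      by_cases h0 : W θ = 0
      · simp [hθ h0]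
      · refine tendsto_const_nhds.congr' ?_
        obtain ⟨n₀, hn₀⟩ := exists_nat_gt (2 / |W θ|)
        filter_upwards [eventually_ge_atTop n₀] with n hn
        rw [hφ1, one_mul]
        have hpos : 0 < |W θ| := abs_pos.2 h0
        rw [div_div_eq_mul_div, div_one, abs_mul, abs_of_nonneg (by positivity : (0:ℝ) ≤ n + 1)]
        rw [div_lt_iff₀ hpos] at hn₀
        have : (n₀ : ℝ) ≤ n := by exact_mod_cast hn
        nlinarith
  have hz : ∀ n : ℕ, ∫ θ in U, deriv φ (W θ / (1 / ((n : ℝ) + 1))) * w' θ v = 0 :=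
    fun n => htr _ (by positivity)
  simp only [hz] at hlim
  exact (tendsto_nhds_unique hlim tendsto_const_nhds)

/-- Stein's identity for a density `p` with score `σ`. -/
theorem stein_identity {Θ : Set (E d)} (hΘ : IsClosed Θ)
    {p f : E d → ℝ} {σ : E d → E d} {f' : E d → E d →L[ℝ] ℝ}
    (hp : ∀ θ ∈ interior Θ, HasFDerivAt p (p θ • innerSL ℝ (σ θ)) θ)
    (hf : ∀ θ ∈ interior Θ, HasFDerivAt f (f' θ) θ)
    (hb : VanishesAtBoundary Θ (fun θ => p θ * f θ)) (a : Fin d)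
    (hint : IntegrableOn (fun θ => p θ * (f' θ (EuclideanSpace.single a 1) + f θ * σ θ a))
      (interior Θ)) :
    ∫ θ in interior Θ, p θ * (f' θ (EuclideanSpace.single a 1) + f θ * σ θ a) = 0 := by
  have heq : ∀ θ, (p θ • f' θ + f θ • (p θ • innerSL ℝ (σ θ))) (EuclideanSpace.single a 1)
      = p θ * (f' θ (EuclideanSpace.single a 1) + f θ * σ θ a) := by
    intro θ
    simp [EuclideanSpace.inner_single_right]
    ring
  have := integral_fderiv_eq_zero_of_vanishesAtBoundary hΘ (w := fun θ => p θ * f θ)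
    (w' := fun θ => p θ • f' θ + f θ • (p θ • innerSL ℝ (σ θ)))
    (fun θ hθ => (hp θ hθ).mul (hf θ hθ)) hb (EuclideanSpace.single a 1)
    (by simpa only [heq] using hint)
  simpa only [heq] using this

/-! ### A uniform law of large numbers -/

section UniformLLN

variable {Ωs 𝒵 : Type*} [MeasurableSpace Ωs] [MeasurableSpace 𝒵] {μ : Measure Ωs} {ρ : Measure 𝒵}

/-- The strong law of large numbers for a function of i.i.d. data `Z` with law `ρ`. -/
lemma tendsto_empiricalMean {Z : ℕ → Ωs → 𝒵}
    (hZ : ∀ k, Measurable (Z k)) (hind : iIndepFun Z μ) (hlaw : ∀ k, μ.map (Z k) = ρ)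
    {f : 𝒵 → ℝ} (hf : Integrable f ρ) :
    ∀ᵐ ω ∂μ, Tendsto (fun n : ℕ => (1 / (n : ℝ)) * ∑ k ∈ Finset.range n, f (Z k ω)) atTop
      (𝓝 (∫ z, f z ∂ρ)) := by
  have hfm : ∀ k, AEMeasurable f (μ.map (Z k)) := fun k => by
    rw [hlaw k]; exact hf.aestronglyMeasurable.aemeasurable
  have hident : ∀ k, IdentDistrib (fun ω => f (Z k ω)) (fun ω => f (Z 0 ω)) μ μ := fun k => by
    have h0 : IdentDistrib (Z k) (Z 0) μ μ :=
      ⟨(hZ k).aemeasurable, (hZ 0).aemeasurable, by rw [hlaw, hlaw]⟩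
    exact h0.comp_of_aemeasurable (hfm k)
  have hint : Integrable (fun ω => f (Z 0 ω)) μ := by
    rw [← hlaw 0] at hf
    exact hf.comp_measurable (hZ 0)
  have h := strong_law_ae_real (fun k ω => f (Z k ω)) hint
    (fun i j hij => (hind.indepFun hij).comp₀ (hZ i).aemeasurable (hZ j).aemeasurable
      (hfm i) (hfm j)) hident
  have hE : ∫ ω, f (Z 0 ω) ∂μ = ∫ z, f z ∂ρ := by
    rw [← hlaw 0, integral_map (hZ 0).aemeasurable]
    rw [hlaw 0]; exact hf.aestronglyMeasurable
  filter_upwards [h] with ω hω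
  rw [hE] at hω
  refine hω.congr fun n => ?_
  rw [div_eq_inv_mul, one_div]

/-- Uniform strong law of large numbers over a compact parameter set, for functions that are
Lipschitz in the parameter with an integrable constant. Since it is uniform, it may be evaluated
along any sequence of parameters, however it depends on the data. -/
theorem tendsto_empiricalMean_uniform {K : Type*} [PseudoMetricSpace K] {Z : ℕ → Ωs → 𝒵}
    (hZ : ∀ k, Measurable (Z k)) (hind : iIndepFun Z μ) (hlaw : ∀ k, μ.map (Z k) = ρ)
    {S : Set K} (hS : IsCompact S) {g : K → 𝒵 → ℝ} (hg : ∀ a ∈ S, Integrable (g a) ρ)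
    {L : 𝒵 → ℝ} (hL : Integrable L ρ)
    (hlip : ∀ᵐ z ∂ρ, ∀ a ∈ S, ∀ b ∈ S, |g a z - g b z| ≤ L z * dist a b) :
    ∀ᵐ ω ∂μ, ∀ a : ℕ → K, (∀ n, 1 ≤ n → a n ∈ S) →
      Tendsto (fun n : ℕ => (1 / (n : ℝ)) * ∑ k ∈ Finset.range n, g (a n) (Z k ω)
        - ∫ z, g (a n) z ∂ρ) atTop (𝓝 0) := by
  have hcov : ∀ j : ℕ, ∃ t ⊆ S, t.Finite ∧ S ⊆ ⋃ x ∈ t, Metric.ball x (1 / ((j : ℝ) + 1)) :=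
    fun j => hS.finite_cover_balls (by positivity)
  choose t htS htf htc using hcov
  have hlipZ : ∀ᵐ ω ∂μ, ∀ k, ∀ a ∈ S, ∀ b ∈ S,
      |g a (Z k ω) - g b (Z k ω)| ≤ L (Z k ω) * dist a b := by
    rw [ae_all_iff]
    intro k
    rw [← hlaw k] at hlip
    exact ae_of_ae_map (hZ k).aemeasurable hlip
  have hcent : ∀ᵐ ω ∂μ, ∀ j, ∀ c ∈ t j, Tendsto (fun n : ℕ => (1 / (n : ℝ)) *
      ∑ k ∈ Finset.range n, g c (Z k ω)) atTop (𝓝 (∫ z, g c z ∂ρ)) := by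
    rw [ae_all_iff]
    intro j
    rw [ae_ball_iff (htf j).countable]
    exact fun c hc => tendsto_empiricalMean hZ hind hlaw (hg c (htS j hc))
  filter_upwards [hlipZ, hcent, tendsto_empiricalMean hZ hind hlaw hL.abs] with ω h1 h2 h3 a ha
  set M := ∫ z, |L z| ∂ρ with hM
  have hM0 : 0 ≤ M := integral_nonneg fun z => abs_nonneg _
  rw [Metric.tendsto_nhds]
  intro ε hε
  obtain ⟨j, hj⟩ := exists_nat_one_div_lt (show 0 < ε / (4 * (M + 1)) by positivity)
  set δ : ℝ := 1 / ((j : ℝ) + 1) with hδ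
  have hδ0 : 0 < δ := by positivity
  have hδM : δ * (M + 1) ≤ ε / 4 := by
    calc δ * (M + 1) ≤ ε / (4 * (M + 1)) * (M + 1) := by gcongr
      _ = ε / 4 := by field_simp
  have e1 : ∀ᶠ n : ℕ in atTop, ∀ c ∈ t j, dist ((1 / (n : ℝ)) *
      ∑ k ∈ Finset.range n, g c (Z k ω)) (∫ z, g c z ∂ρ) < ε / 4 := by
    rw [eventually_all_finite (htf j)]
    exact fun c hc => (Metric.tendsto_nhds.1 (h2 j c hc)) _ (by positivity)
  have e2 : ∀ᶠ n : ℕ in atTop, (1 / (n : ℝ)) * ∑ k ∈ Finset.range n, |L (Z k ω)| < M + 1 :=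
    h3.eventually (gt_mem_nhds (by linarith))
  filter_upwards [e1, e2, eventually_ge_atTop 1] with n hn1 hn2 hn
  obtain ⟨c, hc, hac⟩ : ∃ c ∈ t j, a n ∈ Metric.ball c δ := by
    simpa only [Set.mem_iUnion, exists_prop] using htc j (ha n hn)
  have hd : dist (a n) c ≤ δ := (Metric.mem_ball.1 hac).le
  have hn1c := hn1 c hc
  rw [Real.dist_eq] at hn1c
  have hn0 : (0 : ℝ) ≤ 1 / (n : ℝ) := by positivity
  have i1 : |(1 / (n : ℝ)) * ∑ k ∈ Finset.range n, g (a n) (Z k ω) -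
      (1 / (n : ℝ)) * ∑ k ∈ Finset.range n, g c (Z k ω)| ≤ ε / 4 := by
    rw [← mul_sub, ← Finset.sum_sub_distrib, abs_mul, abs_of_nonneg hn0]
    calc (1 / (n : ℝ)) * |∑ k ∈ Finset.range n, (g (a n) (Z k ω) - g c (Z k ω))|
        ≤ (1 / (n : ℝ)) * ∑ k ∈ Finset.range n, |L (Z k ω)| * δ := by
          gcongr
          refine (Finset.abs_sum_le_sum_abs _ _).trans (Finset.sum_le_sum fun k _ => ?_)
          refine (h1 k _ (ha n hn) _ (htS j hc)).trans ?_
          exact mul_le_mul (le_abs_self _) hd dist_nonneg (abs_nonneg _)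
      _ = δ * ((1 / (n : ℝ)) * ∑ k ∈ Finset.range n, |L (Z k ω)|) := by
          rw [← Finset.sum_mul]; ring
      _ ≤ δ * (M + 1) := by gcongr
      _ ≤ ε / 4 := hδM
  have i2 : |∫ z, g (a n) z ∂ρ - ∫ z, g c z ∂ρ| ≤ ε / 4 := by
    rw [← integral_sub (hg _ (ha n hn)) (hg _ (htS j hc))]
    calc |∫ z, (g (a n) z - g c z) ∂ρ| ≤ ∫ z, δ * |L z| ∂ρ := by
          rw [← Real.norm_eq_abs]
          refine norm_integral_le_of_norm_le (hL.abs.const_mul δ) ?_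
          filter_upwards [hlip] with z hz
          refine (hz _ (ha n hn) _ (htS j hc)).trans ?_
          rw [mul_comm δ]
          exact mul_le_mul (le_abs_self _) hd dist_nonneg (abs_nonneg _)
      _ = δ * M := integral_const_mul _ _
      _ ≤ δ * (M + 1) := by gcongr; linarith
      _ ≤ ε / 4 := hδM
  rw [Real.dist_eq, sub_zero]
  have := abs_le.1 i1
  have := abs_le.1 i2
  have := abs_lt.1 hn1c
  exact abs_lt.2 ⟨by linarith, by linarith⟩

end UniformLLN

/-! ### Second moments of mean-square convergent functions -/

section SecondMoments

variable {𝒵 : Type*} [MeasurableSpace 𝒵] {ρ : Measure 𝒵}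

lemma memLp_two_of_sq_norm {f : 𝒵 → E d} (hm : AEStronglyMeasurable f ρ)
    (hf : Integrable (fun z => ‖f z‖ ^ 2) ρ) : MemLp f 2 ρ :=
  (memLp_two_iff_integrable_sq_norm hm).2 hf

lemma memLp_coord {f : 𝒵 → E d} (hf : MemLp f 2 ρ) (a : Fin d) :
    MemLp (fun z => f z a) 2 ρ := by
  refine hf.mono ?_ (ae_of_all _ fun z => PiLp.norm_apply_le _ _)
  have : Continuous fun v : E d => v a := by fun_prop
  exact this.comp_aestronglyMeasurable hf.aestronglyMeasurable

lemma integrable_coord_mul {f g : 𝒵 → E d} (hf : MemLp f 2 ρ) (hg : MemLp g 2 ρ) (a b : Fin d) :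
    Integrable (fun z => f z a * g z b) ρ :=
  (memLp_coord hf a).integrable_mul (memLp_coord hg b)

lemma integrable_inner {f g : 𝒵 → E d} (hf : MemLp f 2 ρ) (hg : MemLp g 2 ρ) :
    Integrable (fun z => inner ℝ (f z) (g z)) ρ := by
  simp only [PiLp.inner_apply]
  refine integrable_finsetSum _ fun a _ => ?_
  simpa using integrable_coord_mul hg hf a a

/-- Young's inequality for the entries of `v vᵀ - w wᵀ`, with weight `δ`. -/
lemma abs_outer_sub_le {δ : ℝ} (hδ : 0 < δ) (v w : E d) (i j : Fin d) :
    |outer v i j - outer w i j| ≤ (1 + 1 / δ) * ‖v - w‖ ^ 2 + δ * ‖w‖ ^ 2 := by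
  have c1 : |v i - w i| ≤ ‖v - w‖ := PiLp.norm_apply_le (v - w) i
  have c2 : |v j - w j| ≤ ‖v - w‖ := PiLp.norm_apply_le (v - w) j
  have c3 : |w i| ≤ ‖w‖ := PiLp.norm_apply_le w i
  have c4 : |w j| ≤ ‖w‖ := PiLp.norm_apply_le w j
  have hA : 0 ≤ ‖v - w‖ := norm_nonneg _
  have hB : 0 ≤ ‖w‖ := norm_nonneg _
  have e : outer v i j - outer w i j = (v i - w i) * (v j - w j)
      + (v i - w i) * w j + w i * (v j - w j) := by
    simp only [outer, Matrix.of_apply]; ring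
  rw [e]
  generalize ‖v - w‖ = A at *
  generalize ‖w‖ = B at *
  have y : 2 * A * B ≤ 1 / δ * A ^ 2 + δ * B ^ 2 := by
    have : 1 / δ * A ^ 2 + δ * B ^ 2 - 2 * A * B = (A - δ * B) ^ 2 / δ := by
      field_simp; ring
    have h2 : 0 ≤ (A - δ * B) ^ 2 / δ := by positivity
    linarith
  have t1 : |(v i - w i) * (v j - w j)| ≤ A * A := by
    rw [abs_mul]; exact mul_le_mul c1 c2 (abs_nonneg _) hA
  have t2 : |(v i - w i) * w j| ≤ A * B := by
    rw [abs_mul]; exact mul_le_mul c1 c4 (abs_nonneg _) hA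
  have t3 : |w i * (v j - w j)| ≤ B * A := by
    rw [abs_mul]; exact mul_le_mul c3 c2 (abs_nonneg _) hB
  calc _ ≤ _ := abs_add_three _ _ _
    _ ≤ A * A + A * B + B * A := by linarith
    _ ≤ _ := by linarith

lemma abs_integral_outer_sub_le {f g : 𝒵 → E d} (hf : MemLp f 2 ρ) (hg : MemLp g 2 ρ) {δ : ℝ}
    (hδ : 0 < δ) (i j : Fin d) :
    |∫ z, outer (f z) i j ∂ρ - ∫ z, outer (g z) i j ∂ρ| ≤
      (1 + 1 / δ) * (∫ z, ‖f z - g z‖ ^ 2 ∂ρ) + δ * ∫ z, ‖g z‖ ^ 2 ∂ρ := by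
  have I1 : Integrable (fun z => ‖f z - g z‖ ^ 2) ρ := (hf.sub hg).integrable_norm_pow two_ne_zero
  have I0 : Integrable (fun z => ‖g z‖ ^ 2) ρ := hg.integrable_norm_pow two_ne_zero
  have e1 : Integrable (fun z => outer (f z) i j) ρ := integrable_coord_mul hf hf i j
  have e2 : Integrable (fun z => outer (g z) i j) ρ := integrable_coord_mul hg hg i j
  rw [← integral_sub e1 e2, ← integral_const_mul, ← integral_const_mul,
    ← integral_add (I1.const_mul _) (I0.const_mul _), ← Real.norm_eq_abs]
  exact norm_integral_le_of_norm_le ((I1.const_mul _).add (I0.const_mul _))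
    (ae_of_all _ fun z => abs_outer_sub_le hδ _ _ i j)

/-- Convergence in mean square implies convergence of the second moment matrices. -/
lemma tendsto_secondMoment {f : ℕ → 𝒵 → E d} {f₀ : 𝒵 → E d} (hf : ∀ n, 1 ≤ n → MemLp (f n) 2 ρ)
    (hf₀ : MemLp f₀ 2 ρ)
    (hlim : Tendsto (fun n => ∫ z, ‖f n z - f₀ z‖ ^ 2 ∂ρ) atTop (𝓝 0)) (i j : Fin d) :
    Tendsto (fun n => ∫ z, outer (f n z) i j ∂ρ) atTop (𝓝 (∫ z, outer (f₀ z) i j ∂ρ)) := by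
  set V : ℕ → ℝ := fun n => ∫ z, ‖f n z - f₀ z‖ ^ 2 ∂ρ with hV
  set T : ℝ := ∫ z, ‖f₀ z‖ ^ 2 ∂ρ with hT
  -- the weight of Young's inequality; the summand `1 / (n + 1)` keeps it positive
  let δ : ℕ → ℝ := fun n => √(V n) + 1 / ((n : ℝ) + 1)
  have hδ : ∀ n, 0 < δ n := fun n => by positivity
  have hsq : Tendsto (fun n => √(V n)) atTop (𝓝 0) := by
    have := (Real.continuous_sqrt.tendsto 0).comp hlim
    rwa [Real.sqrt_zero] at this
  have hδlim : Tendsto δ atTop (𝓝 0) := by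
    simpa [δ] using hsq.add tendsto_one_div_add_atTop_nhds_zero_nat
  have hbound : ∀ n, 1 ≤ n → |∫ z, outer (f n z) i j ∂ρ - ∫ z, outer (f₀ z) i j ∂ρ|
      ≤ V n + √(V n) + δ n * T := by
    intro n hn
    have hV0 : 0 ≤ V n := integral_nonneg fun z => by positivity
    refine (abs_integral_outer_sub_le (hf n hn) hf₀ (hδ n) i j).trans ?_
    have : 1 / δ n * V n ≤ √(V n) := by
      rw [one_div, inv_mul_le_iff₀ (hδ n)]
      have h2 : V n = √(V n) * √(V n) := (Real.mul_self_sqrt hV0).symm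
      have h3 : √(V n) ≤ δ n := le_add_of_nonneg_right (by positivity)
      calc V n = √(V n) * √(V n) := h2
        _ ≤ δ n * √(V n) := mul_le_mul_of_nonneg_right h3 (Real.sqrt_nonneg _)
    change (1 + 1 / δ n) * V n + δ n * T ≤ _
    linarith
  have hb0 : Tendsto (fun n => V n + √(V n) + δ n * T) atTop (𝓝 0) := by
    simpa using (hlim.add hsq).add (hδlim.mul_const T)
  rw [tendsto_iff_dist_tendsto_zero]
  refine squeeze_zero' (Eventually.of_forall fun n => dist_nonneg) ?_ hb0
  filter_upwards [eventually_ge_atTop 1] with n hn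
  exact hbound n hn

end SecondMoments

/-! ### The support of the model -/

/-- Tonelli's theorem for products of functions of the coordinates. -/
lemma lintegral_pi_prod_eq_prod {α : Type*} [MeasurableSpace α] (ν : Measure α) [SigmaFinite ν] :
    ∀ {n : ℕ} {f : Fin n → α → ENNReal}, (∀ i, Measurable (f i)) →
    ∫⁻ x, ∏ i, f i (x i) ∂(Measure.pi fun _ : Fin n => ν) = ∏ i, ∫⁻ y, f i y ∂ν := by
  intro n
  induction n with
  | zero => intro f _; simp
  | succ n ih =>
    intro f hf
    have hmp := (measurePreserving_piFinSuccAbove (fun _ : Fin (n + 1) => ν) 0).symm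
    rw [← hmp.lintegral_comp_emb (MeasurableEquiv.measurableEmbedding _)]
    simp_rw [MeasurableEquiv.piFinSuccAbove_symm_apply, Fin.insertNthEquiv,
      Fin.prod_univ_succ, Equiv.coe_fn_mk, Fin.insertNth_zero, Fin.cons_zero, Fin.cons_succ]
    have h1 : Measurable fun x : Fin n → α => ∏ i : Fin n, f i.succ (x i) :=
      Finset.measurable_fun_prod _ fun i _ => (hf _).comp (measurable_pi_apply i)
    have h2 := lintegral_prod_mul (μ := ν) (ν := Measure.pi fun _ : Fin n => ν)
      (hf 0).aemeasurable h1.aemeasurable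
    rw [← ih (fun i => hf i.succ), ← h2]
    rfl

namespace Model

instance (P : Model d m) : SigmaFinite P.ν := P.ν_sigmaFinite

variable (P : Model d m)

lemma joint_measurable : Measurable (fun z : E d × E m => P.joint z.2 z.1) :=
  P.lik_measurable.mul (P.prior_measurable.comp measurable_fst)

lemma joint_nonneg (x : E m) (θ : E d) : 0 ≤ P.joint x θ :=
  mul_nonneg (P.lik_nonneg _ _) (P.prior_nonneg _)

lemma setJoint_nonneg (N : ℕ) (x : Fin N → E m) (θ : E d) : 0 ≤ P.setJoint N x θ :=
  mul_nonneg (P.prior_nonneg _) (Finset.prod_nonneg fun _ _ => P.lik_nonneg _ _)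

lemma measurable_pair (N : ℕ) (j : Fin N) :
    Measurable (fun z : E d × (Fin N → E m) => (z.1, z.2 j)) :=
  measurable_fst.prodMk ((measurable_pi_apply j).comp measurable_snd)

lemma lik_apply_measurable (N : ℕ) (j : Fin N) :
    Measurable (fun z : E d × (Fin N → E m) => P.lik (z.2 j) z.1) :=
  P.lik_measurable.comp (measurable_pair N j)

lemma setJoint_measurable (N : ℕ) :
    Measurable (fun z : E d × (Fin N → E m) => P.setJoint N z.2 z.1) :=
  (P.prior_measurable.comp measurable_fst).mul
    (Finset.measurable_fun_prod _ fun i _ => P.lik_apply_measurable N i)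

lemma lik_right_measurable (θ : E d) : Measurable (fun x => P.lik x θ) :=
  P.lik_measurable.comp measurable_prodMk_left

lemma exists_prior_pos_of_null {s : Set (E d)} (hs : ∀ᵐ θ, θ ∉ s → P.prior θ = 0) :
    ∃ θ ∈ s, 0 < P.prior θ := by
  by_contra! h
  have : ∫⁻ θ, ENNReal.ofReal (P.prior θ) = 0 := by
    rw [lintegral_eq_zero_iff P.prior_measurable.ennreal_ofReal]
    filter_upwards [hs] with θ hθ
    by_cases hm : θ ∈ s
    · simpa using h θ hm
    · simp [hθ hm]
  simp [P.lintegral_prior] at this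

/-- A perfect set is not a singleton, so dimension zero is excluded. -/
lemma nontrivial (P : Model d m) : Nontrivial (E d) := by
  obtain ⟨θ, hθ, -⟩ := P.exists_prior_pos_of_null (s := P.paramSet)
    (ae_of_all _ P.prior_eq_zero)
  obtain ⟨y, -, hy⟩ := preperfect_iff_nhds.1 P.paramSet_perfect.acc θ hθ Set.univ univ_mem
  exact ⟨y, θ, hy⟩

variable {P}

/-- The part of the boundary where `‖p(x, θ) θ‖` exceeds a given positive number is discrete, since
`p(x, θ) θ` tends to `0` at every boundary point; hence it is null. -/
lemma ae_joint_eq_zero_of_mem_frontier (hP : BCRBRegular P) (x : E m) :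
    ∀ᵐ θ, θ ∈ frontier P.paramSet → P.joint x θ = 0 := by
  have := P.nontrivial
  have hD : ∀ n : ℕ, volume {θ : E d | θ ∈ frontier P.paramSet ∧
      1 / ((n : ℝ) + 1) < ‖P.joint x θ • θ‖} = 0 := by
    intro n
    refine measure_null_of_locally_null _ fun θ₀ hθ₀ => ⟨{θ₀}, ?_, measure_singleton _⟩
    have h1 := (Metric.tendsto_nhds.1 ((hP.boundary x).1 θ₀ hθ₀.1)) (1 / ((n : ℝ) + 1))
      (by positivity)
    rw [eventually_nhdsWithin_iff] at h1
    rw [mem_nhdsWithin_iff_eventually]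
    filter_upwards [h1] with θ hθ hmem
    by_contra hne
    have h2 := hθ ⟨P.paramSet_perfect.closed.frontier_subset hmem.1, hne⟩
    rw [dist_zero_right] at h2
    exact absurd hmem.2 (not_lt.2 h2.le)
  have h0 : ∀ᵐ θ : E d, θ ≠ 0 := by
    simp [ae_iff]
  have hD' : ∀ᵐ θ : E d, ∀ n : ℕ, ¬ (θ ∈ frontier P.paramSet ∧
      1 / ((n : ℝ) + 1) < ‖P.joint x θ • θ‖) := by
    rw [ae_all_iff]
    intro n
    rw [ae_iff]
    simpa only [not_not] using hD n
  filter_upwards [h0, hD'] with θ hθ hn hfr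
  by_contra hne
  have hpos : 0 < ‖P.joint x θ • θ‖ := norm_pos_iff.2 (smul_ne_zero hne hθ)
  obtain ⟨n, hn'⟩ := exists_nat_one_div_lt hpos
  exact hn n ⟨hfr, hn'⟩

lemma exists_lik_pos {θ : E d} (hθ : 0 < P.prior θ) {s : Set (E m)}
    (hs : ∀ᵐ x ∂P.ν, x ∉ s → P.lik x θ = 0) : ∃ x ∈ s, 0 < P.lik x θ := by
  by_contra! h
  have h1 := P.lintegral_lik θ hθ
  have : ∫⁻ x, ENNReal.ofReal (P.lik x θ) ∂P.ν = 0 := by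
    rw [lintegral_eq_zero_iff (P.lik_right_measurable θ).ennreal_ofReal]
    filter_upwards [hs] with x hx
    by_cases hm : x ∈ s
    · simpa using h x hm
    · simp [hx hm]
  simp [h1] at this

/-- The prior gives no mass to the boundary of the parameter set. -/
lemma ae_prior_eq_zero (hP : BCRBRegular P) :
    ∀ᵐ θ, θ ∉ interior P.paramSet → P.prior θ = 0 := by
  have hm : MeasurableSet {z : E m × E d | z.2 ∈ frontier P.paramSet → P.joint z.1 z.2 = 0} := by
    have h1 : MeasurableSet {z : E m × E d | z.2 ∈ frontier P.paramSet} :=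
      measurable_snd isClosed_frontier.measurableSet
    have h2 : MeasurableSet {z : E m × E d | P.joint z.1 z.2 = 0} :=
      (P.joint_measurable.comp measurable_swap) (measurableSet_singleton 0)
    exact h1.imp h2
  have h := (Measure.ae_ae_comm (μ := P.ν) (ν := (volume : Measure (E d)))
    (p := fun x θ => θ ∈ frontier P.paramSet → P.joint x θ = 0) hm).1
    (ae_of_all _ fun x => ae_joint_eq_zero_of_mem_frontier hP x)
  filter_upwards [h] with θ hθ hint
  by_cases hΘ : θ ∈ P.paramSet
  · by_contra hne
    have hpos : 0 < P.prior θ := lt_of_le_of_ne (P.prior_nonneg θ) (Ne.symm hne)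
    have hfr : θ ∈ frontier P.paramSet := ⟨subset_closure hΘ, hint⟩
    obtain ⟨x, hx, -⟩ := exists_lik_pos hpos (s := ∅) (by
      filter_upwards [hθ] with x hx _
      have := hx hfr
      simpa [joint, hne] using this)
    exact hx
  · exact P.prior_eq_zero θ hΘ

/-- Since the support of the joint density does not depend on the parameter, the prior is positive
on the whole interior. -/
lemma prior_pos (hP : BCRBRegular P) {θ : E d} (hθ : θ ∈ interior P.paramSet) :
    0 < P.prior θ := by
  obtain ⟨A, hA⟩ := hP.common_support
  obtain ⟨θ₀, hθ₀, hp₀⟩ := P.exists_prior_pos_of_null (ae_prior_eq_zero hP)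
  obtain ⟨x₀, -, hx₀⟩ := exists_lik_pos hp₀ (s := Set.univ) (by simp)
  have h1 : x₀ ∈ {x | 0 < P.joint x θ₀} := mul_pos hx₀ hp₀
  rw [hA θ₀ hθ₀, ← hA θ hθ] at h1
  exact pos_of_mul_pos_right h1 (P.lik_nonneg _ _)

/-- An observation is possible for all interior parameters or for none. -/
lemma lik_pos_or_eq_zero (hP : BCRBRegular P) (x : E m) :
    (∀ θ ∈ interior P.paramSet, 0 < P.lik x θ) ∨ (∀ θ ∈ interior P.paramSet, P.lik x θ = 0) := by
  obtain ⟨A, hA⟩ := hP.common_support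
  by_cases hx : x ∈ A
  · refine Or.inl fun θ hθ => ?_
    rw [← hA θ hθ] at hx
    exact pos_of_mul_pos_left hx (P.prior_nonneg _)
  · refine Or.inr fun θ hθ => ?_
    rw [← hA θ hθ] at hx
    by_contra hne
    exact hx (mul_pos (lt_of_le_of_ne (P.lik_nonneg _ _) (Ne.symm hne)) (prior_pos hP hθ))

/-! ### Marginals of the data law -/

lemma prior_mul_lintegral_lik (θ : E d) :
    ENNReal.ofReal (P.prior θ) * ∫⁻ x, ENNReal.ofReal (P.lik x θ) ∂P.ν =
      ENNReal.ofReal (P.prior θ) := by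
  rcases (P.prior_nonneg θ).eq_or_lt with h | h
  · simp [← h]
  · rw [P.lintegral_lik θ h, mul_one]

lemma map_fst_jointLaw : P.jointLaw.map Prod.fst = P.priorLaw := by
  ext s hs
  rw [Measure.map_apply measurable_fst hs, jointLaw, priorLaw,
    withDensity_apply _ (measurable_fst hs), withDensity_apply _ hs,
    ← Set.prod_univ, ← Measure.prod_restrict, Measure.restrict_univ,
    lintegral_prod _ P.joint_measurable.ennreal_ofReal.aemeasurable]
  refine lintegral_congr fun θ => ?_
  simp only [joint, mul_comm (P.lik _ _), ENNReal.ofReal_mul (P.prior_nonneg _)]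
  rw [lintegral_const_mul _ (P.lik_right_measurable θ).ennreal_ofReal, prior_mul_lintegral_lik]

/-- Each observation, paired with the parameter, follows the joint law of a single observation. -/
lemma map_pair_setLaw (N : ℕ) (j : Fin N) :
    (P.setLaw N).map (fun z => (z.1, z.2 j)) = P.jointLaw := by
  classical
  ext s hs
  have hpre := measurable_pair (d := d) (m := m) N j hs
  rw [Measure.map_apply (measurable_pair N j) hs, setLaw, jointLaw,
    withDensity_apply _ hpre, withDensity_apply _ hs,
    ← lintegral_indicator hpre, ← lintegral_indicator hs,
    lintegral_prod _ ((P.setJoint_measurable N).ennreal_ofReal.indicator hpre).aemeasurable,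
    lintegral_prod _ (P.joint_measurable.ennreal_ofReal.indicator hs).aemeasurable]
  refine lintegral_congr fun θ => ?_
  let c : Fin N → E m → ENNReal := fun k y =>
    ENNReal.ofReal (P.lik y θ) * (if k = j then s.indicator 1 (θ, y) else 1)
  have hcm : ∀ k, Measurable (c k) := by
    intro k
    refine (P.lik_right_measurable θ).ennreal_ofReal.mul ?_
    by_cases hk : k = j
    · simp only [hk, if_true]
      exact (measurable_one.indicator hs).comp measurable_prodMk_left
    · simp [hk]
  have hL : ∀ x : Fin N → E m,
      ((fun z : E d × (Fin N → E m) => (z.1, z.2 j)) ⁻¹' s).indicator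
        (fun z => ENNReal.ofReal (P.setJoint N z.2 z.1)) (θ, x)
      = ENNReal.ofReal (P.prior θ) * ∏ k, c k (x k) := by
    intro x
    have h1 : ∏ k, c k (x k) = (∏ k, ENNReal.ofReal (P.lik (x k) θ)) * s.indicator 1 (θ, x j) := by
      simp only [c]
      rw [Finset.prod_mul_distrib, Finset.prod_ite_eq']
      simp
    rw [h1]
    by_cases hx : (θ, x j) ∈ s
    · have hx' : (θ, x) ∈ (fun z : E d × (Fin N → E m) => (z.1, z.2 j)) ⁻¹' s := hx
      rw [Set.indicator_of_mem hx', Set.indicator_of_mem hx]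
      simp only [setJoint, Pi.one_apply, mul_one]
      rw [ENNReal.ofReal_mul (P.prior_nonneg _),
        ENNReal.ofReal_prod_of_nonneg fun _ _ => P.lik_nonneg _ _]
    · have hx' : (θ, x) ∉ (fun z : E d × (Fin N → E m) => (z.1, z.2 j)) ⁻¹' s := hx
      rw [Set.indicator_of_notMem hx', Set.indicator_of_notMem hx]
      simp
  have hR : ∀ y : E m, s.indicator (fun z : E d × E m => ENNReal.ofReal (P.joint z.2 z.1)) (θ, y)
      = ENNReal.ofReal (P.prior θ) * c j y := by
    intro y
    simp only [c, if_true]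
    by_cases hx : (θ, y) ∈ s
    · rw [Set.indicator_of_mem hx, Set.indicator_of_mem hx]
      simp only [joint, Pi.one_apply, mul_one]
      rw [mul_comm, ENNReal.ofReal_mul (P.prior_nonneg _)]
    · simp [hx]
  simp only [hL, hR]
  have hprod : Measurable fun x : Fin N → E m => ∏ k, c k (x k) :=
    Finset.measurable_fun_prod _ fun k _ => (hcm k).comp (measurable_pi_apply k)
  rw [lintegral_const_mul _ hprod, lintegral_const_mul _ (hcm j),
    lintegral_pi_prod_eq_prod P.ν hcm]
  rcases (P.prior_nonneg θ).eq_or_lt with h | h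
  · simp [← h]
  · congr 1
    rw [Finset.prod_eq_single j]
    · intro k _ hk
      simp only [c, hk, if_false, mul_one]
      exact P.lintegral_lik θ h
    · simp

lemma map_fst_setLaw {N : ℕ} (hN : 1 ≤ N) : (P.setLaw N).map Prod.fst = P.priorLaw := by
  rw [← map_fst_jointLaw, ← map_pair_setLaw N ⟨0, hN⟩,
    Measure.map_map measurable_fst (measurable_pair N _)]
  rfl

lemma ae_priorLaw_interior (hP : BCRBRegular P) :
    ∀ᵐ θ ∂P.priorLaw, θ ∈ interior P.paramSet := by
  rw [priorLaw, ae_withDensity_iff P.prior_measurable.ennreal_ofReal]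
  filter_upwards [ae_prior_eq_zero hP] with θ hθ hne
  by_contra hn
  exact hne (by simp [hθ hn])

lemma ae_jointLaw_interior (hP : BCRBRegular P) :
    ∀ᵐ z ∂P.jointLaw, z.1 ∈ interior P.paramSet ∧ 0 < P.lik z.2 z.1 := by
  have h1 : ∀ᵐ z ∂P.jointLaw, z.1 ∈ interior P.paramSet := by
    have := ae_priorLaw_interior hP
    rw [← map_fst_jointLaw] at this
    exact ae_of_ae_map measurable_fst.aemeasurable this
  have h2 : ∀ᵐ z ∂P.jointLaw, 0 < P.lik z.2 z.1 := by
    rw [jointLaw, ae_withDensity_iff P.joint_measurable.ennreal_ofReal]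
    refine ae_of_all _ fun z hz => ?_
    have : 0 < P.joint z.2 z.1 := by simpa using hz
    exact pos_of_mul_pos_left this (P.prior_nonneg _)
  exact h1.and h2

lemma ae_setLaw_interior (hP : BCRBRegular P) {N : ℕ} (hN : 1 ≤ N) :
    ∀ᵐ z ∂P.setLaw N, z.1 ∈ interior P.paramSet ∧ ∀ i, 0 < P.lik (z.2 i) z.1 := by
  have h : ∀ᵐ z ∂P.setLaw N, ∀ i, z.1 ∈ interior P.paramSet ∧ 0 < P.lik (z.2 i) z.1 := by
    rw [ae_all_iff]
    intro i
    have := ae_jointLaw_interior hP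
    rw [← map_pair_setLaw N i] at this
    exact ae_of_ae_map (measurable_pair N i).aemeasurable this
  filter_upwards [h] with z hz
  exact ⟨(hz ⟨0, hN⟩).1, fun i => (hz i).2⟩

/-! ### Derivatives of the densities -/

lemma hasFDerivAt_of_log {p : E d → ℝ} {U : Set (E d)} (hU : IsOpen U) (hpos : ∀ θ ∈ U, 0 < p θ)
    {θ : E d} (hθ : θ ∈ U) {g : E d} (hd : HasGradientAt (fun t => Real.log (p t)) g θ) :
    HasFDerivAt p (p θ • innerSL ℝ g) θ := by
  have h1 := hd.hasFDerivAt.exp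
  rw [Real.exp_log (hpos θ hθ)] at h1
  refine (h1.congr_of_eventuallyEq ?_).congr_fderiv ?_
  · filter_upwards [hU.mem_nhds hθ] with t ht
    exact (Real.exp_log (hpos t ht)).symm
  · ext v; simp

lemma hasGradientAt_add {f g : E d → ℝ} {u v θ : E d} (hf : HasGradientAt f u θ)
    (hg : HasGradientAt g v θ) : HasGradientAt (fun t => f t + g t) (u + v) θ := by
  rw [hasGradientAt_iff_hasFDerivAt, map_add]
  exact hf.hasFDerivAt.add hg.hasFDerivAt

lemma hasGradientAt_sum {ι : Type*} (s : Finset ι) {f : ι → E d → ℝ} {u : ι → E d} {θ : E d}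
    (hf : ∀ i ∈ s, HasGradientAt (f i) (u i) θ) :
    HasGradientAt (fun t => ∑ i ∈ s, f i t) (∑ i ∈ s, u i) θ := by
  rw [hasGradientAt_iff_hasFDerivAt, map_sum]
  exact HasFDerivAt.fun_sum fun i hi => (hf i hi).hasFDerivAt

variable {SP : Set (E kP)} {SF : Set (E kF)} {sP : E kP → E d → E d} {sF : E kF → E m → E d → E d}

lemma hasGradientAt_log_prior (hP : BCRBRegular P) {θ : E d} (hθ : θ ∈ interior P.paramSet) :
    HasGradientAt (fun t => Real.log (P.prior t)) (P.priorScore θ) θ :=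
  (hP.prior_differentiable θ hθ (prior_pos hP hθ)).hasGradientAt

lemma hasGradientAt_log_lik (hP : BCRBRegular P) (hregF : FisherMatchingRegular P SF sF)
    {θ : E d} (hθ : θ ∈ interior P.paramSet) {x : E m} (hx : 0 < P.lik x θ) :
    HasGradientAt (fun t => Real.log (P.lik x t)) (P.fisherScore x θ) θ :=
  (hregF.lik_differentiable x θ hθ (mul_pos hx (prior_pos hP hθ))).hasGradientAt

lemma hasFDerivAt_prior (hP : BCRBRegular P) {θ : E d} (hθ : θ ∈ interior P.paramSet) :
    HasFDerivAt P.prior (P.prior θ • innerSL ℝ (P.priorScore θ)) θ :=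
  hasFDerivAt_of_log isOpen_interior (fun _ h => prior_pos hP h) hθ (hasGradientAt_log_prior hP hθ)

lemma lik_pos_of_pos (hP : BCRBRegular P) {θ : E d} (hθ : θ ∈ interior P.paramSet) {x : E m}
    (hx : 0 < P.lik x θ) : ∀ t ∈ interior P.paramSet, 0 < P.lik x t := by
  rcases lik_pos_or_eq_zero hP x with h | h
  · exact h
  · exact absurd (h θ hθ) hx.ne'

lemma hasGradientAt_log_joint (hP : BCRBRegular P) (hregF : FisherMatchingRegular P SF sF)
    {θ : E d} (hθ : θ ∈ interior P.paramSet) {x : E m} (hx : 0 < P.lik x θ) :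
    HasGradientAt (fun t => Real.log (P.joint x t)) (P.fisherScore x θ + P.priorScore θ) θ := by
  refine (hasGradientAt_add (hasGradientAt_log_lik hP hregF hθ hx)
    (hasGradientAt_log_prior hP hθ)).congr_of_eventuallyEq ?_
  filter_upwards [isOpen_interior.mem_nhds hθ] with t ht
  exact Real.log_mul (lik_pos_of_pos hP hθ hx t ht).ne' (prior_pos hP ht).ne'

lemma jointScore_eq (hP : BCRBRegular P) (hregF : FisherMatchingRegular P SF sF)
    {θ : E d} (hθ : θ ∈ interior P.paramSet) {x : E m} (hx : 0 < P.lik x θ) :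
    P.jointScore x θ = P.fisherScore x θ + P.priorScore θ :=
  (hasGradientAt_log_joint hP hregF hθ hx).gradient

lemma bayesScore_eq (hP : BCRBRegular P) (hregF : FisherMatchingRegular P SF sF) {N : ℕ}
    {θ : E d} (hθ : θ ∈ interior P.paramSet) {x : Fin N → E m} (hx : ∀ i, 0 < P.lik (x i) θ) :
    P.bayesScore N x θ = P.priorScore θ + ∑ i, P.fisherScore (x i) θ := by
  refine HasGradientAt.gradient (HasGradientAt.congr_of_eventuallyEq
    (hasGradientAt_add (hasGradientAt_log_prior hP hθ)
    (hasGradientAt_sum Finset.univ fun i _ => hasGradientAt_log_lik hP hregF hθ (hx i))) ?_)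
  filter_upwards [isOpen_interior.mem_nhds hθ] with t ht
  have hl : ∀ i ∈ Finset.univ, P.lik (x i) t ≠ 0 :=
    fun i _ => (lik_pos_of_pos hP hθ (hx i) t ht).ne'
  rw [setJoint, Real.log_mul (prior_pos hP ht).ne' (Finset.prod_ne_zero_iff.2 hl),
    Real.log_prod hl]

lemma hasFDerivAt_joint (hP : BCRBRegular P) (hregF : FisherMatchingRegular P SF sF)
    {θ : E d} (hθ : θ ∈ interior P.paramSet) {x : E m} (hx : 0 < P.lik x θ) :
    HasFDerivAt (P.joint x) (P.joint x θ • innerSL ℝ (P.fisherScore x θ + P.priorScore θ)) θ :=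
  hasFDerivAt_of_log isOpen_interior
    (fun _ h => mul_pos (lik_pos_of_pos hP hθ hx _ h) (prior_pos hP h)) hθ
    (hasGradientAt_log_joint hP hregF hθ hx)

lemma priorScore_memLp (hP : BCRBRegular P) (hregP : PriorMatchingRegular P SP sP)
    (hreal : PriorRealizable P SP sP) : MemLp P.priorScore 2 P.priorLaw := by
  obtain ⟨Ω, hΩ, h⟩ := hreal
  refine memLp_two_of_sq_norm ?_ hregP.score_sq_integrable
  refine (hregP.net_measurable Ω hΩ).aestronglyMeasurable.congr ?_
  filter_upwards [ae_priorLaw_interior hP] with θ hθ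
  exact h θ hθ (prior_pos hP hθ)

lemma fisherScore_memLp (hP : BCRBRegular P) (hregF : FisherMatchingRegular P SF sF)
    (hreal : FisherRealizable P SF sF) :
    MemLp (fun z : E d × E m => P.fisherScore z.2 z.1) 2 P.jointLaw := by
  obtain ⟨Ω, hΩ, h⟩ := hreal
  refine memLp_two_of_sq_norm ?_ hregF.score_sq_integrable
  refine (hregF.net_measurable Ω hΩ).aestronglyMeasurable.congr ?_
  filter_upwards [ae_jointLaw_interior hP] with z hz
  exact h z.2 z.1 hz.1 (mul_pos hz.2 (prior_pos hP hz.1))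

lemma memLp_comp_fst {f : E d → E d} (hf : MemLp f 2 P.priorLaw) :
    MemLp (fun z : E d × E m => f z.1) 2 P.jointLaw := by
  rw [← map_fst_jointLaw] at hf
  exact hf.comp_of_map measurable_fst.aemeasurable

end Model

namespace Model

variable {P : Model d m}
variable {SP : Set (E kP)} {SF : Set (E kF)} {sP : E kP → E d → E d} {sF : E kF → E m → E d → E d}

/-! ### Stein's identity for the model -/

lemma integral_priorLaw (f : E d → ℝ) :
    ∫ θ, f θ ∂P.priorLaw = ∫ θ, P.prior θ * f θ := by
  rw [priorLaw, integral_withDensity_eq_integral_toReal_smul P.prior_measurable.ennreal_ofReal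
    (ae_of_all _ fun _ => ENNReal.ofReal_lt_top)]
  simp only [ENNReal.toReal_ofReal (P.prior_nonneg _), smul_eq_mul]

lemma integral_jointLaw (f : E d × E m → ℝ) :
    ∫ z, f z ∂P.jointLaw = ∫ z, P.joint z.2 z.1 * f z ∂(volume.prod P.ν) := by
  rw [jointLaw, integral_withDensity_eq_integral_toReal_smul P.joint_measurable.ennreal_ofReal
    (ae_of_all _ fun _ => ENNReal.ofReal_lt_top)]
  simp only [ENNReal.toReal_ofReal (P.joint_nonneg _ _), smul_eq_mul]

lemma integral_setLaw {N : ℕ} (f : E d × (Fin N → E m) → ℝ) :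
    ∫ z, f z ∂P.setLaw N =
      ∫ z, P.setJoint N z.2 z.1 * f z ∂(volume.prod (Measure.pi fun _ => P.ν)) := by
  rw [setLaw, integral_withDensity_eq_integral_toReal_smul (P.setJoint_measurable N).ennreal_ofReal
    (ae_of_all _ fun _ => ENNReal.ofReal_lt_top)]
  simp only [ENNReal.toReal_ofReal (P.setJoint_nonneg _ _ _), smul_eq_mul]

lemma integrable_priorLaw {f : E d → ℝ} (hf : Integrable f P.priorLaw) :
    Integrable (fun θ => P.prior θ * f θ) := by
  rw [priorLaw, integrable_withDensity_iff_integrable_smul' P.prior_measurable.ennreal_ofReal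
    (ae_of_all _ fun _ => ENNReal.ofReal_lt_top)] at hf
  simpa only [ENNReal.toReal_ofReal (P.prior_nonneg _), smul_eq_mul] using hf

lemma integrable_jointLaw {f : E d × E m → ℝ} (hf : Integrable f P.jointLaw) :
    Integrable (fun z => P.joint z.2 z.1 * f z) (volume.prod P.ν) := by
  rw [jointLaw, integrable_withDensity_iff_integrable_smul' P.joint_measurable.ennreal_ofReal
    (ae_of_all _ fun _ => ENNReal.ofReal_lt_top)] at hf
  simpa only [ENNReal.toReal_ofReal (P.joint_nonneg _ _), smul_eq_mul] using hf

lemma integrable_setLaw {N : ℕ} {f : E d × (Fin N → E m) → ℝ} (hf : Integrable f (P.setLaw N)) :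
    Integrable (fun z => P.setJoint N z.2 z.1 * f z)
      (volume.prod (Measure.pi fun _ => P.ν)) := by
  rw [setLaw, integrable_withDensity_iff_integrable_smul' (P.setJoint_measurable N).ennreal_ofReal
    (ae_of_all _ fun _ => ENNReal.ofReal_lt_top)] at hf
  simpa only [ENNReal.toReal_ofReal (P.setJoint_nonneg _ _ _), smul_eq_mul] using hf

/-- Stein's identity for the prior. -/
theorem integral_priorLaw_stein (hP : BCRBRegular P) {f : E d → ℝ} {f' : E d → E d →L[ℝ] ℝ}
    (hf : ∀ θ ∈ interior P.paramSet, HasFDerivAt f (f' θ) θ)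
    (hb : VanishesAtBoundary P.paramSet (fun θ => P.prior θ * f θ)) (a : Fin d)
    (hint : Integrable (fun θ => f' θ (EuclideanSpace.single a 1) + f θ * P.priorScore θ a)
      P.priorLaw) :
    ∫ θ, (f' θ (EuclideanSpace.single a 1) + f θ * P.priorScore θ a) ∂P.priorLaw = 0 := by
  rw [integral_priorLaw, ← setIntegral_eq_integral_of_ae_compl_eq_zero (s := interior P.paramSet)]
  · exact stein_identity P.paramSet_perfect.closed (fun θ hθ => hasFDerivAt_prior hP hθ) hf hb a
      (integrable_priorLaw hint).integrableOn
  · filter_upwards [ae_prior_eq_zero hP] with θ hθ hn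
    rw [hθ hn, zero_mul]

/-- Stein's identity for the joint law of the parameter and a single observation, where the
derivative is taken in the parameter. -/
theorem integral_jointLaw_stein (hP : BCRBRegular P) (hregF : FisherMatchingRegular P SF sF)
    {f : E m → E d → ℝ} {f' : E m → E d → E d →L[ℝ] ℝ}
    (hf : ∀ x, ∀ θ ∈ interior P.paramSet, 0 < P.lik x θ → HasFDerivAt (f x) (f' x θ) θ)
    (hb : ∀ x, VanishesAtBoundary P.paramSet (fun θ => P.joint x θ * f x θ)) (a : Fin d)
    (hint : Integrable (fun z : E d × E m => f' z.2 z.1 (EuclideanSpace.single a 1) +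
      f z.2 z.1 * (P.fisherScore z.2 z.1 + P.priorScore z.1) a) P.jointLaw) :
    ∫ z, (f' z.2 z.1 (EuclideanSpace.single a 1) +
      f z.2 z.1 * (P.fisherScore z.2 z.1 + P.priorScore z.1) a) ∂P.jointLaw = 0 := by
  have hi := integrable_jointLaw hint
  rw [integral_jointLaw, integral_prod_symm _ hi]
  have hi' : ∀ᵐ x ∂P.ν, Integrable (fun θ => P.joint x θ *
      (f' x θ (EuclideanSpace.single a 1) + f x θ * (P.fisherScore x θ + P.priorScore θ) a)) :=
    hi.swap.prod_right_ae
  refine integral_eq_zero_of_ae ?_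
  filter_upwards [hi'] with x hx
  rw [← setIntegral_eq_integral_of_ae_compl_eq_zero (s := interior P.paramSet)]
  · rcases lik_pos_or_eq_zero hP x with h | h
    · exact stein_identity P.paramSet_perfect.closed
        (fun θ hθ => hasFDerivAt_joint hP hregF hθ (h θ hθ)) (fun θ hθ => hf x θ hθ (h θ hθ))
        (hb x) a hx.integrableOn
    · refine setIntegral_eq_zero_of_forall_eq_zero fun θ hθ => ?_
      simp [joint, h θ hθ]
  · filter_upwards [ae_prior_eq_zero hP] with θ hθ hn
    simp [joint, hθ hn]

/-! ### The conditional mean of the Fisher score -/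

lemma vanishesAtBoundary_of_hasCompactSupport {Θ : Set (E d)} {φ g : E d → ℝ}
    (hc : HasCompactSupport φ) (hs : tsupport φ ⊆ interior Θ) :
    VanishesAtBoundary Θ (fun θ => g θ * φ θ) := by
  constructor
  · intro θ₀ hθ₀
    have h1 : θ₀ ∉ tsupport φ := fun h => hθ₀.2 (hs h)
    have h2 : φ =ᶠ[𝓝 θ₀] 0 := notMem_tsupport_iff_eventuallyEq.1 h1
    refine Tendsto.mono_left (tendsto_const_nhds.congr' ?_) nhdsWithin_le_nhds
    filter_upwards [h2] with θ hθ
    simp [hθ]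
  · refine Tendsto.mono_left (tendsto_const_nhds.congr' ?_) inf_le_left
    rw [Metric.cobounded_eq_cocompact]
    filter_upwards [hc.compl_mem_cocompact] with θ hθ
    simp [image_eq_zero_of_notMem_tsupport hθ]

lemma isProbabilityMeasure_priorLaw : IsProbabilityMeasure P.priorLaw := by
  constructor
  rw [priorLaw, withDensity_apply _ MeasurableSet.univ, Measure.restrict_univ, P.lintegral_prior]

lemma isProbabilityMeasure_jointLaw : IsProbabilityMeasure P.jointLaw := by
  constructor
  have := isProbabilityMeasure_priorLaw (P := P)
  rw [← Set.preimage_univ (f := Prod.fst), ← Measure.map_apply measurable_fst MeasurableSet.univ,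
    map_fst_jointLaw, measure_univ]

/-- The Fisher score is orthogonal to all test functions of the parameter: subtract Stein's
identity for the prior from the one for the joint law. -/
lemma integral_test_mul_fisherScore (hP : BCRBRegular P) (hregF : FisherMatchingRegular P SF sF)
    (hp2 : MemLp P.priorScore 2 P.priorLaw)
    (hf2 : MemLp (fun z : E d × E m => P.fisherScore z.2 z.1) 2 P.jointLaw)
    {φ : E d → ℝ} (hφ : ContDiff ℝ 1 φ) (hc : HasCompactSupport φ)
    (hs : tsupport φ ⊆ interior P.paramSet) (a : Fin d) :
    ∫ z, φ z.1 * P.fisherScore z.2 z.1 a ∂P.jointLaw = 0 := by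
  have := isProbabilityMeasure_priorLaw (P := P)
  have := isProbabilityMeasure_jointLaw (P := P)
  set e : E d := EuclideanSpace.single a 1
  have hφ' : Continuous (fun θ => fderiv ℝ φ θ e) :=
    (hφ.continuous_fderiv one_ne_zero).clm_apply continuous_const
  have hc' : HasCompactSupport (fun θ => fderiv ℝ φ θ e) := by
    refine (hc.fderiv (𝕜 := ℝ)).mono' fun θ hθ => ?_
    refine subset_tsupport _ fun h => hθ ?_
    simp [h]
  obtain ⟨C, hC⟩ := hφ.continuous.bounded_above_of_compact_support hc
  obtain ⟨C', hC'⟩ := hφ'.bounded_above_of_compact_support hc'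
  have hi1 : Integrable (fun θ => fderiv ℝ φ θ e) P.priorLaw :=
    Integrable.of_bound hφ'.aestronglyMeasurable C' (ae_of_all _ hC')
  have hi2 : Integrable (fun θ => φ θ * P.priorScore θ a) P.priorLaw :=
    ((memLp_coord hp2 a).integrable one_le_two).bdd_mul
      hφ.continuous.aestronglyMeasurable (ae_of_all _ hC)
  have hi3 : Integrable (fun z : E d × E m => φ z.1 * P.fisherScore z.2 z.1 a) P.jointLaw :=
    ((memLp_coord hf2 a).integrable one_le_two).bdd_mul
      (hφ.continuous.comp continuous_fst).aestronglyMeasurable (ae_of_all _ fun z => hC z.1)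
  have hi12 := hi1.add hi2
  have hsum : (fun z : E d × E m => fderiv ℝ φ z.1 e + φ z.1 *
      (P.fisherScore z.2 z.1 + P.priorScore z.1) a) = fun z =>
      (fderiv ℝ φ z.1 e + φ z.1 * P.priorScore z.1 a) + φ z.1 * P.fisherScore z.2 z.1 a := by
    ext z; simp only [PiLp.add_apply]; ring
  have hi12' : Integrable (fun z : E d × E m =>
      fderiv ℝ φ z.1 e + φ z.1 * P.priorScore z.1 a) P.jointLaw := by
    rw [← map_fst_jointLaw] at hi12
    exact hi12.comp_measurable measurable_fst
  have s1 := integral_priorLaw_stein hP (f := φ) (f' := fderiv ℝ φ)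
    (fun θ _ => (hφ.differentiable one_ne_zero θ).hasFDerivAt)
    (vanishesAtBoundary_of_hasCompactSupport hc hs) a hi12
  have s2 := integral_jointLaw_stein hP hregF (f := fun _ => φ) (f' := fun _ => fderiv ℝ φ)
    (fun _ θ _ _ => (hφ.differentiable one_ne_zero θ).hasFDerivAt)
    (fun x => vanishesAtBoundary_of_hasCompactSupport hc hs) a
    (by rw [hsum]; exact hi12'.add hi3)
  rw [hsum, integral_add hi12' hi3] at s2
  have s3 : ∫ z : E d × E m, (fderiv ℝ φ z.1 e + φ z.1 * P.priorScore z.1 a) ∂P.jointLaw = 0 := by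
    rw [← s1]
    have hm := hi12.aestronglyMeasurable
    rw [← map_fst_jointLaw] at hm ⊢
    exact (integral_map measurable_fst.aemeasurable hm).symm
  rw [s3, zero_add] at s2
  exact s2

/-- The Fisher score has conditional mean zero given the parameter. Interchanging differentiation
with the integral over observations is not needed: the conditional mean is orthogonal to all test
functions. -/
theorem ae_integral_lik_mul_fisherScore_eq_zero (hP : BCRBRegular P)
    (hregF : FisherMatchingRegular P SF sF) (hp2 : MemLp P.priorScore 2 P.priorLaw)
    (hf2 : MemLp (fun z : E d × E m => P.fisherScore z.2 z.1) 2 P.jointLaw) (a : Fin d) :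
    ∀ᵐ θ, θ ∈ interior P.paramSet → ∫ x, P.lik x θ * P.fisherScore x θ a ∂P.ν = 0 := by
  have := isProbabilityMeasure_jointLaw (P := P)
  have hi0 := integrable_jointLaw ((memLp_coord hf2 a).integrable one_le_two)
  have hi : Integrable (fun θ => ∫ x, P.joint x θ * P.fisherScore x θ a ∂P.ν) :=
    hi0.integral_prod_left
  have h := isOpen_interior.ae_eq_zero_of_integral_contDiff_smul_eq_zero
    (U := interior P.paramSet) (hi.locallyIntegrable.locallyIntegrableOn _) (by
    intro φ hφ hc hs
    have hφ1 : ContDiff ℝ 1 φ := hφ.of_le (by exact_mod_cast le_top)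
    obtain ⟨C, hC⟩ := hφ.continuous.bounded_above_of_compact_support hc
    have h1 := integral_test_mul_fisherScore hP hregF hp2 hf2 hφ1 hc hs a
    rw [integral_jointLaw, integral_prod] at h1
    · rw [← h1]
      refine integral_congr_ae (ae_of_all _ fun θ => ?_)
      dsimp only
      rw [smul_eq_mul, ← integral_const_mul]
      refine integral_congr_ae (ae_of_all _ fun x => ?_)
      dsimp only
      ring
    · refine integrable_jointLaw ?_
      exact ((memLp_coord hf2 a).integrable one_le_two).bdd_mul
        (hφ.continuous.comp continuous_fst).aestronglyMeasurable (ae_of_all _ fun z => hC z.1))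
  filter_upwards [h] with θ hθ hU
  have h1 := hθ hU
  have h2 : ∀ x, P.joint x θ * P.fisherScore x θ a
      = P.prior θ * (P.lik x θ * P.fisherScore x θ a) := fun x => by rw [joint]; ring
  simp only [h2] at h1
  rw [integral_const_mul] at h1
  exact (mul_eq_zero.1 h1).resolve_left (prior_pos hP hU).ne'

/-! ### The Bayesian Fisher information of `N` observations -/

/-- A product of functions of the single observations has expectation zero if one of the factors is
a Fisher score. -/
lemma integral_setLaw_eq_zero (hP : BCRBRegular P)
    (hregF : FisherMatchingRegular P SF sF) (hp2 : MemLp P.priorScore 2 P.priorLaw)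
    (hf2 : MemLp (fun z : E d × E m => P.fisherScore z.2 z.1) 2 P.jointLaw) {N : ℕ} {a : Fin d}
    {F : E d × (Fin N → E m) → ℝ} (hF : Integrable F (P.setLaw N)) (r : E d → ℝ)
    (h : Fin N → E d → E m → ℝ) {i : Fin N} (hi : ∀ θ x, h i θ x = P.fisherScore x θ a)
    (hFh : ∀ z, F z = r z.1 * ∏ k, h k z.1 (z.2 k)) :
    ∫ z, F z ∂P.setLaw N = 0 := by
  rw [integral_setLaw, integral_prod _ (integrable_setLaw hF)]
  refine integral_eq_zero_of_ae ?_
  filter_upwards [ae_prior_eq_zero hP,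
    ae_integral_lik_mul_fisherScore_eq_zero hP hregF hp2 hf2 a] with θ h0 hθ
  by_cases hU : θ ∈ interior P.paramSet
  · have h1 : ∀ x : Fin N → E m, P.setJoint N x θ * F (θ, x) =
        (P.prior θ * r θ) * ∏ k, (P.lik (x k) θ * h k θ (x k)) := by
      intro x
      rw [hFh, setJoint, Finset.prod_mul_distrib]; ring
    simp only [h1]
    rw [integral_const_mul, integral_fintype_prod_eq_prod (𝕜 := ℝ)
      (f := fun k y => P.lik y θ * h k θ y), Finset.prod_eq_zero (Finset.mem_univ i), mul_zero]
    · rfl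
    · simp only [hi]; exact hθ hU
  · simp [setJoint, h0 hU]

end Model

/-- Matrix of second moments of a random vector. -/
def secondMoment {𝒵 : Type*} [MeasurableSpace 𝒵] (ρ : Measure 𝒵) (f : 𝒵 → E d) :
    Matrix (Fin d) (Fin d) ℝ :=
  Matrix.of fun i j => ∫ z, outer (f z) i j ∂ρ

lemma secondMoment_posSemidef {𝒵 : Type*} [MeasurableSpace 𝒵] {ρ : Measure 𝒵} {f : 𝒵 → E d}
    (hf : MemLp f 2 ρ) : (secondMoment ρ f).PosSemidef := by
  refine Matrix.PosSemidef.of_dotProduct_mulVec_nonneg ?_ fun x => ?_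
  · ext i j
    simp only [Matrix.conjTranspose_apply, secondMoment, Matrix.of_apply, outer, star_trivial]
    simp only [mul_comm]
  · have h1 : star x ⬝ᵥ (secondMoment ρ f).mulVec x
        = ∫ z, (∑ i, x i * f z i) ^ 2 ∂ρ := by
      have h2 : ∀ z, (∑ i, x i * f z i) ^ 2 = ∑ i, ∑ j, (x i * x j) * (f z i * f z j) := by
        intro z
        rw [sq, Finset.sum_mul_sum]
        exact Finset.sum_congr rfl fun i _ => Finset.sum_congr rfl fun j _ => by ring
      simp only [h2]
      rw [integral_finsetSum _ fun i _ => integrable_finsetSum _ fun j _ =>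
        (integrable_coord_mul hf hf i j).const_mul _]
      simp only [dotProduct, Matrix.mulVec, star_trivial, Finset.mul_sum]
      refine Finset.sum_congr rfl fun i _ => ?_
      rw [integral_finsetSum _ fun j _ => (integrable_coord_mul hf hf i j).const_mul _]
      refine Finset.sum_congr rfl fun j _ => ?_
      rw [integral_const_mul]
      simp only [secondMoment, Matrix.of_apply, outer]
      ring
    rw [h1]
    exact integral_nonneg fun z => sq_nonneg _

namespace Model

variable {P : Model d m}
variable {SP : Set (E kP)} {SF : Set (E kF)} {sP : E kP → E d → E d} {sF : E kF → E m → E d → E d}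

lemma memLp_prior_setLaw {f : E d → E d} (hf : MemLp f 2 P.priorLaw) {N : ℕ} (hN : 1 ≤ N) :
    MemLp (fun z : E d × (Fin N → E m) => f z.1) 2 (P.setLaw N) := by
  rw [← map_fst_setLaw hN] at hf
  exact hf.comp_of_map measurable_fst.aemeasurable

lemma memLp_joint_setLaw {f : E d × E m → E d} (hf : MemLp f 2 P.jointLaw) {N : ℕ} (i : Fin N) :
    MemLp (fun z : E d × (Fin N → E m) => f (z.1, z.2 i)) 2 (P.setLaw N) := by
  rw [← map_pair_setLaw N i] at hf
  exact hf.comp_of_map (measurable_pair N i).aemeasurable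

lemma bayesScore_memLp (hP : BCRBRegular P) (hregF : FisherMatchingRegular P SF sF)
    (hp2 : MemLp P.priorScore 2 P.priorLaw)
    (hf2 : MemLp (fun z : E d × E m => P.fisherScore z.2 z.1) 2 P.jointLaw) {N : ℕ} (hN : 1 ≤ N) :
    MemLp (fun z : E d × (Fin N → E m) => P.bayesScore N z.2 z.1) 2 (P.setLaw N) := by
  have h1 : MemLp (fun z : E d × (Fin N → E m) =>
      P.priorScore z.1 + ∑ i, P.fisherScore (z.2 i) z.1) 2 (P.setLaw N) :=
    (memLp_prior_setLaw hp2 hN).add (memLp_finsetSum _ fun i _ => memLp_joint_setLaw hf2 i)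
  refine h1.ae_eq ?_
  filter_upwards [ae_setLaw_interior hP hN] with z hz
  exact (bayesScore_eq hP hregF hz.1 hz.2).symm

lemma integral_add_four {𝒵 : Type*} [MeasurableSpace 𝒵] {ρ : Measure 𝒵} {f g h k : 𝒵 → ℝ}
    (hf : Integrable f ρ) (hg : Integrable g ρ) (hh : Integrable h ρ) (hk : Integrable k ρ) :
    ∫ z, (f z + g z + h z + k z) ∂ρ =
      ∫ z, f z ∂ρ + ∫ z, g z ∂ρ + ∫ z, h z ∂ρ + ∫ z, k z ∂ρ := by
  have h1 : Integrable (fun z => f z + g z) ρ := hf.add hg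
  have h2 : Integrable (fun z => f z + g z + h z) ρ := h1.add hh
  rw [integral_add h2 hk, integral_add h1 hh, integral_add hf hg]

/-- The scores of the prior and of the single observations are uncorrelated, so the information
is additive. -/
theorem bayesFIM_eq (hP : BCRBRegular P) (hregF : FisherMatchingRegular P SF sF)
    (hp2 : MemLp P.priorScore 2 P.priorLaw)
    (hf2 : MemLp (fun z : E d × E m => P.fisherScore z.2 z.1) 2 P.jointLaw) {N : ℕ} (hN : 1 ≤ N) :
    P.bayesFIM N = (N : ℝ) • secondMoment P.jointLaw (fun z => P.fisherScore z.2 z.1) +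
      secondMoment P.priorLaw P.priorScore := by
  classical
  ext a b
  simp only [bayesFIM, Matrix.of_apply, Matrix.add_apply, Matrix.smul_apply, smul_eq_mul]
  have q2 := memLp_prior_setLaw (m := m) hp2 hN
  have u2 : ∀ i : Fin N, MemLp (fun z : E d × (Fin N → E m) => P.fisherScore (z.2 i) z.1) 2
    (P.setLaw N) := fun i => memLp_joint_setLaw hf2 i
  have e1 : ∫ z, outer (P.bayesScore N z.2 z.1) a b ∂P.setLaw N =
      ∫ z, (P.priorScore z.1 a * P.priorScore z.1 b
        + ∑ i, P.priorScore z.1 a * P.fisherScore (z.2 i) z.1 b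
        + ∑ i, P.fisherScore (z.2 i) z.1 a * P.priorScore z.1 b
        + ∑ i, ∑ j, P.fisherScore (z.2 i) z.1 a * P.fisherScore (z.2 j) z.1 b) ∂P.setLaw N := by
    refine integral_congr_ae ?_
    filter_upwards [ae_setLaw_interior hP hN] with z hz
    rw [bayesScore_eq hP hregF hz.1 hz.2]
    simp only [outer, Matrix.of_apply, PiLp.add_apply, WithLp.ofLp_sum, Finset.sum_apply]
    rw [add_mul, mul_add, mul_add, Finset.sum_mul_sum, Finset.mul_sum, Finset.sum_mul]
    ring
  have i1 := integrable_coord_mul q2 q2 a b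
  have i2 := fun i => integrable_coord_mul q2 (u2 i) a b
  have i3 := fun i => integrable_coord_mul (u2 i) q2 a b
  have i4 := fun i j => integrable_coord_mul (u2 i) (u2 j) a b
  have s2 := integrable_finsetSum Finset.univ fun i _ => i2 i
  have s3 := integrable_finsetSum Finset.univ fun i _ => i3 i
  have s4 := integrable_finsetSum Finset.univ fun i _ =>
    integrable_finsetSum Finset.univ fun j _ => i4 i j
  rw [e1, integral_add_four i1 s2 s3 s4,
    integral_finsetSum _ fun i _ => i2 i, integral_finsetSum _ fun i _ => i3 i,
    integral_finsetSum _ fun i _ => integrable_finsetSum _ fun j _ => i4 i j]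
  have z2 : ∀ i : Fin N, ∫ z : E d × (Fin N → E m),
      P.priorScore z.1 a * P.fisherScore (z.2 i) z.1 b ∂P.setLaw N = 0 := fun i =>
    integral_setLaw_eq_zero hP hregF hp2 hf2 (a := b) (i2 i) (fun θ => P.priorScore θ a)
      (fun k θ x => if k = i then P.fisherScore x θ b else 1) (i := i) (by simp) (by simp)
  have z3 : ∀ i : Fin N, ∫ z : E d × (Fin N → E m),
      P.fisherScore (z.2 i) z.1 a * P.priorScore z.1 b ∂P.setLaw N = 0 := fun i =>
    integral_setLaw_eq_zero hP hregF hp2 hf2 (a := a) (i3 i) (fun θ => P.priorScore θ b)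
      (fun k θ x => if k = i then P.fisherScore x θ a else 1) (i := i) (by simp)
      (by simp [mul_comm])
  have z4 : ∀ i j : Fin N, i ≠ j → ∫ z : E d × (Fin N → E m),
      P.fisherScore (z.2 i) z.1 a * P.fisherScore (z.2 j) z.1 b ∂P.setLaw N = 0 :=
    fun i j hij =>
    integral_setLaw_eq_zero hP hregF hp2 hf2 (a := a) (i4 i j) (fun _ => 1)
      (fun k θ x => (if k = i then P.fisherScore x θ a else 1) *
        (if k = j then P.fisherScore x θ b else 1)) (i := i) (by simp [hij])
      (fun z => by rw [Finset.prod_mul_distrib]; simp)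
  have d4 : ∀ i : Fin N, ∫ z : E d × (Fin N → E m),
      P.fisherScore (z.2 i) z.1 a * P.fisherScore (z.2 i) z.1 b ∂P.setLaw N =
      secondMoment P.jointLaw (fun z => P.fisherScore z.2 z.1) a b := by
    intro i
    simp only [secondMoment, Matrix.of_apply, outer]
    have hm : AEStronglyMeasurable (fun z : E d × E m =>
        P.fisherScore z.2 z.1 a * P.fisherScore z.2 z.1 b) P.jointLaw :=
      (integrable_coord_mul hf2 hf2 a b).aestronglyMeasurable
    rw [← map_pair_setLaw N i] at hm ⊢
    exact (integral_map (measurable_pair N i).aemeasurable hm).symm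
  have d1 : ∫ z : E d × (Fin N → E m), P.priorScore z.1 a * P.priorScore z.1 b ∂P.setLaw N =
      secondMoment P.priorLaw P.priorScore a b := by
    simp only [secondMoment, Matrix.of_apply, outer]
    have hm : AEStronglyMeasurable (fun θ : E d =>
        P.priorScore θ a * P.priorScore θ b) P.priorLaw :=
      (integrable_coord_mul hp2 hp2 a b).aestronglyMeasurable
    rw [← map_fst_setLaw hN] at hm ⊢
    exact (integral_map measurable_fst.aemeasurable hm).symm
  have d5 : ∀ i : Fin N, ∫ z : E d × (Fin N → E m),
      ∑ j, P.fisherScore (z.2 i) z.1 a * P.fisherScore (z.2 j) z.1 b ∂P.setLaw N =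
      secondMoment P.jointLaw (fun z => P.fisherScore z.2 z.1) a b := by
    intro i
    rw [integral_finsetSum _ fun j _ => i4 i j,
      Finset.sum_eq_single i (fun j _ hj => z4 i j hj.symm) (by simp), d4]
  simp only [z2, z3, d5, d1, Finset.sum_const_zero, add_zero, Finset.sum_const, Finset.card_univ,
    Fintype.card_fin, nsmul_eq_mul]
  ring

lemma singleFIM_eq (hP : BCRBRegular P) (hregF : FisherMatchingRegular P SF sF)
    (hp2 : MemLp P.priorScore 2 P.priorLaw)
    (hf2 : MemLp (fun z : E d × E m => P.fisherScore z.2 z.1) 2 P.jointLaw) :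
    P.singleFIM = P.bayesFIM 1 := by
  ext a b
  simp only [singleFIM, bayesFIM, Matrix.of_apply]
  have hj : MemLp (fun z : E d × E m => P.jointScore z.2 z.1) 2 P.jointLaw := by
    refine (hf2.add (memLp_comp_fst hp2)).ae_eq ?_
    filter_upwards [ae_jointLaw_interior hP] with z hz
    exact (jointScore_eq hP hregF hz.1 hz.2).symm
  have hm : AEStronglyMeasurable (fun z : E d × E m => outer (P.jointScore z.2 z.1) a b)
      P.jointLaw := (integrable_coord_mul hj hj a b).aestronglyMeasurable
  rw [← map_pair_setLaw 1 0] at hm ⊢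
  rw [integral_map (measurable_pair 1 0).aemeasurable hm]
  refine integral_congr_ae ?_
  filter_upwards [ae_setLaw_interior hP le_rfl] with z hz
  rw [bayesScore_eq hP hregF hz.1 hz.2, jointScore_eq hP hregF hz.1 (hz.2 0)]
  simp [add_comm]

theorem bayesFIM_posDef (hP : BCRBRegular P) (hregF : FisherMatchingRegular P SF sF)
    (hp2 : MemLp P.priorScore 2 P.priorLaw)
    (hf2 : MemLp (fun z : E d × E m => P.fisherScore z.2 z.1) 2 P.jointLaw) {N : ℕ} (hN : 1 ≤ N) :
    (P.bayesFIM N).PosDef := by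
  have h1 := hP.singleFIM_posDef
  rw [singleFIM_eq hP hregF hp2 hf2] at h1
  have h2 : P.bayesFIM N = P.bayesFIM 1 +
      ((N : ℝ) - 1) • secondMoment P.jointLaw (fun z => P.fisherScore z.2 z.1) := by
    rw [bayesFIM_eq hP hregF hp2 hf2 hN, bayesFIM_eq hP hregF hp2 hf2 le_rfl, sub_smul]
    simp only [Nat.cast_one, one_smul]
    abel
  rw [h2]
  have hN' : (0 : ℝ) ≤ (N : ℝ) - 1 := by
    rw [sub_nonneg]; exact_mod_cast hN
  exact h1.add_posSemidef ((secondMoment_posSemidef hf2).smul hN')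

end Model

/-! ### Lipschitz constants of the score matching objectives -/

/-- Trace of an endomorphism of `ℝ^d`, in the standard basis. -/
def opTrace (L : E d →L[ℝ] E d) : ℝ := ∑ i, L (EuclideanSpace.single i 1) i

lemma traceJacobian_eq (s : E d → E d) (θ : E d) : traceJacobian s θ = opTrace (fderiv ℝ s θ) := rfl

lemma abs_entry_le_frobNorm (A : Matrix (Fin d) (Fin d) ℝ) (i j : Fin d) :
    |A i j| ≤ frobNorm A := by
  refine Real.abs_le_sqrt ?_
  calc A i j ^ 2 ≤ ∑ j, A i j ^ 2 :=
        Finset.single_le_sum (f := fun j => A i j ^ 2) (fun _ _ => sq_nonneg _) (Finset.mem_univ j)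
    _ ≤ ∑ i, ∑ j, A i j ^ 2 :=
        Finset.single_le_sum (f := fun i => ∑ j, A i j ^ 2)
          (fun _ _ => Finset.sum_nonneg fun _ _ => sq_nonneg _) (Finset.mem_univ i)

lemma abs_entry_sub_le (L M : E d →L[ℝ] E d) (i : Fin d) :
    |L (EuclideanSpace.single i 1) i - M (EuclideanSpace.single i 1) i| ≤ ‖L - M‖ := by
  have h1 := PiLp.norm_apply_le ((L - M) (EuclideanSpace.single i 1)) i
  have h2 := (L - M).le_opNorm (EuclideanSpace.single i 1)
  rw [PiLp.norm_single, norm_one, mul_one] at h2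
  exact h1.trans h2

lemma abs_opTrace_sub_le (L M : E d →L[ℝ] E d) : |opTrace L - opTrace M| ≤ d * ‖L - M‖ := by
  rw [opTrace, opTrace, ← Finset.sum_sub_distrib]
  calc _ ≤ ∑ i : Fin d, ‖L - M‖ :=
        (Finset.abs_sum_le_sum_abs _ _).trans (Finset.sum_le_sum fun i _ => abs_entry_sub_le L M i)
    _ = d * ‖L - M‖ := by simp

lemma abs_sq_norm_sub_le (v w : E d) :
    |‖v‖ ^ 2 - ‖w‖ ^ 2| ≤ d * frobNorm (outer v - outer w) := by
  have h : ‖v‖ ^ 2 - ‖w‖ ^ 2 = ∑ i, (outer v - outer w) i i := by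
    rw [EuclideanSpace.real_norm_sq_eq, EuclideanSpace.real_norm_sq_eq, ← Finset.sum_sub_distrib]
    refine Finset.sum_congr rfl fun i _ => ?_
    simp only [outer, Matrix.sub_apply, Matrix.of_apply]; ring
  rw [h]
  calc _ ≤ ∑ i : Fin d, frobNorm (outer v - outer w) :=
        (Finset.abs_sum_le_sum_abs _ _).trans
          (Finset.sum_le_sum fun i _ => abs_entry_le_frobNorm _ i i)
    _ = _ := by simp

section Lipschitz

variable {k : ℕ} {𝒵 : Type*} [MeasurableSpace 𝒵] {ρ : Measure 𝒵} {S : Set (E k)}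
  {f : E k → 𝒵 → E d} {D : E k → 𝒵 → E d →L[ℝ] E d}

lemma LipschitzInParam.outer (h : LipschitzInParam ρ S f D) :
    ∃ L : 𝒵 → ℝ, Integrable L ρ ∧ ∀ᵐ z ∂ρ, ∀ a ∈ S, ∀ b ∈ S, ∀ i j,
      |outer (f a z) i j - outer (f b z) i j| ≤ L z * dist a b := by
  obtain ⟨ξ, τ, ζ, -, -, hζ, h⟩ := h
  refine ⟨ζ, hζ, ?_⟩
  filter_upwards [h] with z hz a ha b hb i j
  rw [dist_eq_norm]
  exact (abs_entry_le_frobNorm (LBCRB.outer (f a z) - LBCRB.outer (f b z)) i j).trans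
    (hz a ha b hb).2.2

lemma LipschitzInParam.jacobian (h : LipschitzInParam ρ S f D) :
    ∃ L : 𝒵 → ℝ, Integrable L ρ ∧ ∀ᵐ z ∂ρ, ∀ a ∈ S, ∀ b ∈ S,
      ‖D a z - D b z‖ ≤ L z * dist a b := by
  obtain ⟨ξ, τ, ζ, -, hτ, -, h⟩ := h
  refine ⟨τ, hτ, ?_⟩
  filter_upwards [h] with z hz a ha b hb
  rw [dist_eq_norm]
  exact (hz a ha b hb).2.1

lemma LipschitzInParam.net (h : LipschitzInParam ρ S f D) :
    ∃ L : 𝒵 → ℝ, MemLp L 2 ρ ∧ (∀ z, 0 ≤ L z) ∧ ∀ᵐ z ∂ρ, ∀ a ∈ S, ∀ b ∈ S,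
      ‖f a z - f b z‖ ≤ L z * dist a b := by
  obtain ⟨ξ, τ, ζ, hξ, -, -, h⟩ := h
  -- only `ξ ^ 2` is known to be measurable, so `|ξ|` is recovered as its square root
  have habs : ∀ z, √(ξ z ^ 2) = |ξ z| := fun z => Real.sqrt_sq_eq_abs _
  have hm : AEStronglyMeasurable (fun z => √(ξ z ^ 2)) ρ :=
    Real.continuous_sqrt.comp_aestronglyMeasurable hξ.aestronglyMeasurable
  refine ⟨fun z => √(ξ z ^ 2), ?_, fun z => Real.sqrt_nonneg _, ?_⟩
  · rw [memLp_two_iff_integrable_sq hm]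
    simpa only [habs, sq_abs] using hξ
  · filter_upwards [h] with z hz a ha b hb
    rw [habs, dist_eq_norm]
    exact (hz a ha b hb).1.trans
      (mul_le_mul_of_nonneg_right (le_abs_self _) (norm_nonneg _))

lemma LipschitzInParam.objective (h : LipschitzInParam ρ S f D) :
    ∃ L : 𝒵 → ℝ, Integrable L ρ ∧ ∀ᵐ z ∂ρ, ∀ a ∈ S, ∀ b ∈ S,
      |‖f a z‖ ^ 2 - ‖f b z‖ ^ 2 + 2 * (opTrace (D a z) - opTrace (D b z))| ≤ L z * dist a b := by
  obtain ⟨ξ, τ, ζ, -, hτ, hζ, h⟩ := h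
  refine ⟨fun z => d * ζ z + 2 * (d * τ z), (hζ.const_mul _).add ((hτ.const_mul _).const_mul _), ?_⟩
  filter_upwards [h] with z hz a ha b hb
  rw [dist_eq_norm]
  obtain ⟨-, h2, h3⟩ := hz a ha b hb
  have d0 : (0 : ℝ) ≤ d := Nat.cast_nonneg d
  have e1 := (abs_sq_norm_sub_le (f a z) (f b z)).trans (mul_le_mul_of_nonneg_left h3 d0)
  have e2 := (abs_opTrace_sub_le (D a z) (D b z)).trans (mul_le_mul_of_nonneg_left h2 d0)
  calc _ ≤ |‖f a z‖ ^ 2 - ‖f b z‖ ^ 2| + |2 * (opTrace (D a z) - opTrace (D b z))| :=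
        abs_add_le _ _
    _ ≤ d * (ζ z * ‖a - b‖) + 2 * (d * (τ z * ‖a - b‖)) := by
        rw [abs_mul, abs_two]; linarith
    _ = _ := by ring

end Lipschitz

/-! ### Score matching identities -/

namespace Model

variable {P : Model d m}
variable {SP : Set (E kP)} {SF : Set (E kF)} {sP : E kP → E d → E d} {sF : E kF → E m → E d → E d}

lemma priorNet_memLp (hregP : PriorMatchingRegular P SP sP) {Ω : E kP} (hΩ : Ω ∈ SP) :
    MemLp (sP Ω) 2 P.priorLaw :=
  memLp_two_of_sq_norm (hregP.net_measurable Ω hΩ).aestronglyMeasurable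
    (hregP.net_sq_integrable Ω hΩ)

lemma fisherNet_memLp (hregF : FisherMatchingRegular P SF sF) {Ω : E kF} (hΩ : Ω ∈ SF) :
    MemLp (fun z : E d × E m => sF Ω z.2 z.1) 2 P.jointLaw :=
  memLp_two_of_sq_norm (hregF.net_measurable Ω hΩ).aestronglyMeasurable
    (hregF.net_sq_integrable Ω hΩ)

/-- The Jacobian of the Fisher network is measurable in the data up to a null set, as a limit of
difference quotients. -/
lemma fisherNet_jacobian_aemeasurable (hP : BCRBRegular P) (hregF : FisherMatchingRegular P SF sF)
    {Ω : E kF} (hΩ : Ω ∈ SF) (i : Fin d) :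
    AEMeasurable (fun z : E d × E m =>
      fderiv ℝ (sF Ω z.2) z.1 (EuclideanSpace.single i 1) i) P.jointLaw := by
  set e : E d := EuclideanSpace.single i 1
  refine aemeasurable_of_tendsto_metrizable_ae' (f := fun (n : ℕ) (z : E d × E m) =>
    ((n : ℝ) • (sF Ω z.2 (z.1 + (n : ℝ)⁻¹ • e) - sF Ω z.2 z.1)) i) ?_ ?_
  · intro n
    have h1 : Measurable (fun z : E d × E m => sF Ω z.2 (z.1 + (n : ℝ)⁻¹ • e)) :=
      (hregF.net_measurable Ω hΩ).comp ((measurable_fst.add_const _).prodMk measurable_snd)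
    have h2 := (h1.sub (hregF.net_measurable Ω hΩ)).const_smul (n : ℝ)
    have h3 : Measurable fun v : E d => v i := by fun_prop
    exact (h3.comp h2).aemeasurable
  · filter_upwards [ae_jointLaw_interior hP] with z hz
    have h1 := (hregF.net_differentiable Ω hΩ z.2 z.1 hz.1
      (mul_pos hz.2 (prior_pos hP hz.1))).hasFDerivAt.lim_real e
    have h2 := h1.comp tendsto_natCast_atTop_atTop
    have h3 : Continuous fun v : E d => v i := by fun_prop
    exact (h3.tendsto _).comp h2

lemma integrable_priorNet_jacobian_sub
    (hlip : LipschitzInParam P.priorLaw SP sP (fun Ω θ => fderiv ℝ (sP Ω) θ))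
    {Ω Ω₀ : E kP} (hΩ : Ω ∈ SP) (hΩ₀ : Ω₀ ∈ SP) (i : Fin d) :
    Integrable (fun θ => fderiv ℝ (sP Ω) θ (EuclideanSpace.single i 1) i -
      fderiv ℝ (sP Ω₀) θ (EuclideanSpace.single i 1) i) P.priorLaw := by
  obtain ⟨L, hL, h⟩ := hlip.jacobian
  have hm : ∀ Ω, Measurable fun θ => fderiv ℝ (sP Ω) θ (EuclideanSpace.single i 1) i := fun Ω => by
    have h3 : Measurable fun v : E d => v i := by fun_prop
    exact h3.comp (measurable_fderiv_apply_const ℝ (sP Ω) _)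
  refine (hL.mul_const (dist Ω Ω₀)).mono' ((hm Ω).sub (hm Ω₀)).aestronglyMeasurable ?_
  filter_upwards [h] with θ hθ
  exact (abs_entry_sub_le _ _ i).trans (hθ Ω hΩ Ω₀ hΩ₀)

lemma integrable_fisherNet_jacobian_sub (hP : BCRBRegular P)
    (hregF : FisherMatchingRegular P SF sF)
    (hlip : LipschitzInParam P.jointLaw SF (fun Ω z => sF Ω z.2 z.1)
      (fun Ω z => fderiv ℝ (sF Ω z.2) z.1))
    {Ω Ω₀ : E kF} (hΩ : Ω ∈ SF) (hΩ₀ : Ω₀ ∈ SF) (i : Fin d) :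
    Integrable (fun z : E d × E m => fderiv ℝ (sF Ω z.2) z.1 (EuclideanSpace.single i 1) i -
      fderiv ℝ (sF Ω₀ z.2) z.1 (EuclideanSpace.single i 1) i) P.jointLaw := by
  obtain ⟨L, hL, h⟩ := hlip.jacobian
  refine (hL.mul_const (dist Ω Ω₀)).mono'
    ((fisherNet_jacobian_aemeasurable hP hregF hΩ i).sub
      (fisherNet_jacobian_aemeasurable hP hregF hΩ₀ i)).aestronglyMeasurable ?_
  filter_upwards [h] with z hz
  exact (abs_entry_sub_le _ _ i).trans (hz Ω hΩ Ω₀ hΩ₀)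

lemma inner_eq_sum (u v : E d) : inner ℝ u v = ∑ i, u i * v i := by
  rw [PiLp.inner_apply]
  exact Finset.sum_congr rfl fun i _ => by simp [mul_comm]

/-- Stein's identity for the difference of two prior networks. The Jacobians themselves need not
be integrable, but their difference is. -/
lemma integral_priorNet_stein (hP : BCRBRegular P) (hregP : PriorMatchingRegular P SP sP)
    (hlip : LipschitzInParam P.priorLaw SP sP (fun Ω θ => fderiv ℝ (sP Ω) θ))
    (hp2 : MemLp P.priorScore 2 P.priorLaw)
    {Ω Ω₀ : E kP} (hΩ : Ω ∈ SP) (hΩ₀ : Ω₀ ∈ SP) :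
    Integrable (fun θ => opTrace (fderiv ℝ (sP Ω) θ) - opTrace (fderiv ℝ (sP Ω₀) θ) +
      inner ℝ (sP Ω θ - sP Ω₀ θ) (P.priorScore θ)) P.priorLaw ∧
    ∫ θ, (opTrace (fderiv ℝ (sP Ω) θ) - opTrace (fderiv ℝ (sP Ω₀) θ) +
      inner ℝ (sP Ω θ - sP Ω₀ θ) (P.priorScore θ)) ∂P.priorLaw = 0 := by
  have hh2 : MemLp (fun θ => sP Ω θ - sP Ω₀ θ) 2 P.priorLaw :=
    (priorNet_memLp hregP hΩ).sub (priorNet_memLp hregP hΩ₀)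
  have e : ∀ θ, opTrace (fderiv ℝ (sP Ω) θ) - opTrace (fderiv ℝ (sP Ω₀) θ) +
      inner ℝ (sP Ω θ - sP Ω₀ θ) (P.priorScore θ) = ∑ i,
      (((EuclideanSpace.proj i : E d →L[ℝ] ℝ).comp (fderiv ℝ (sP Ω) θ - fderiv ℝ (sP Ω₀) θ))
        (EuclideanSpace.single i 1) + (sP Ω θ - sP Ω₀ θ) i * P.priorScore θ i) := by
    intro θ
    rw [Finset.sum_add_distrib, inner_eq_sum, opTrace, opTrace, ← Finset.sum_sub_distrib]
    rfl
  have hint : ∀ i, Integrable (fun θ =>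
      ((EuclideanSpace.proj i : E d →L[ℝ] ℝ).comp (fderiv ℝ (sP Ω) θ - fderiv ℝ (sP Ω₀) θ))
        (EuclideanSpace.single i 1) + (sP Ω θ - sP Ω₀ θ) i * P.priorScore θ i) P.priorLaw :=
    fun i => (integrable_priorNet_jacobian_sub hlip hΩ hΩ₀ i).add
      (integrable_coord_mul hh2 hp2 i i)
  simp only [e]
  refine ⟨integrable_finsetSum _ fun i _ => hint i, ?_⟩
  rw [integral_finsetSum _ fun i _ => hint i]
  refine Finset.sum_eq_zero fun i _ => ?_
  refine integral_priorLaw_stein hP (f := fun θ => (sP Ω θ - sP Ω₀ θ) i)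
    (f' := fun θ => (EuclideanSpace.proj i : E d →L[ℝ] ℝ).comp
      (fderiv ℝ (sP Ω) θ - fderiv ℝ (sP Ω₀) θ)) ?_ ?_ i (hint i)
  · intro θ hθ
    have hpos := prior_pos hP hθ
    exact (EuclideanSpace.proj i : E d →L[ℝ] ℝ).hasFDerivAt.comp θ
      ((hregP.net_differentiable Ω hΩ θ hθ hpos).hasFDerivAt.sub
      (hregP.net_differentiable Ω₀ hΩ₀ θ hθ hpos).hasFDerivAt)
  · have := ((hregP.boundary Ω hΩ).coord i).sub ((hregP.boundary Ω₀ hΩ₀).coord i)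
    simpa [mul_sub] using this

/-- Stein's identity for the difference of two Fisher networks. -/
lemma integral_fisherNet_stein (hP : BCRBRegular P) (hregF : FisherMatchingRegular P SF sF)
    (hlip : LipschitzInParam P.jointLaw SF (fun Ω z => sF Ω z.2 z.1)
      (fun Ω z => fderiv ℝ (sF Ω z.2) z.1))
    (hp2 : MemLp P.priorScore 2 P.priorLaw)
    (hf2 : MemLp (fun z : E d × E m => P.fisherScore z.2 z.1) 2 P.jointLaw)
    {Ω Ω₀ : E kF} (hΩ : Ω ∈ SF) (hΩ₀ : Ω₀ ∈ SF) :
    Integrable (fun z : E d × E m =>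
      opTrace (fderiv ℝ (sF Ω z.2) z.1) - opTrace (fderiv ℝ (sF Ω₀ z.2) z.1) +
      inner ℝ (sF Ω z.2 z.1 - sF Ω₀ z.2 z.1) (P.fisherScore z.2 z.1 + P.priorScore z.1))
      P.jointLaw ∧
    ∫ z : E d × E m,
      (opTrace (fderiv ℝ (sF Ω z.2) z.1) - opTrace (fderiv ℝ (sF Ω₀ z.2) z.1) +
      inner ℝ (sF Ω z.2 z.1 - sF Ω₀ z.2 z.1) (P.fisherScore z.2 z.1 + P.priorScore z.1))
      ∂P.jointLaw = 0 := by
  have hh2 : MemLp (fun z : E d × E m => sF Ω z.2 z.1 - sF Ω₀ z.2 z.1) 2 P.jointLaw :=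
    (fisherNet_memLp hregF hΩ).sub (fisherNet_memLp hregF hΩ₀)
  have hs2 : MemLp (fun z : E d × E m => P.fisherScore z.2 z.1 + P.priorScore z.1) 2 P.jointLaw :=
    hf2.add (memLp_comp_fst hp2)
  have e : ∀ z : E d × E m,
      opTrace (fderiv ℝ (sF Ω z.2) z.1) - opTrace (fderiv ℝ (sF Ω₀ z.2) z.1) +
      inner ℝ (sF Ω z.2 z.1 - sF Ω₀ z.2 z.1) (P.fisherScore z.2 z.1 + P.priorScore z.1) = ∑ i,
      (((EuclideanSpace.proj i : E d →L[ℝ] ℝ).comp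
        (fderiv ℝ (sF Ω z.2) z.1 - fderiv ℝ (sF Ω₀ z.2) z.1)) (EuclideanSpace.single i 1) +
        (sF Ω z.2 z.1 - sF Ω₀ z.2 z.1) i * (P.fisherScore z.2 z.1 + P.priorScore z.1) i) := by
    intro z
    rw [Finset.sum_add_distrib, inner_eq_sum, opTrace, opTrace, ← Finset.sum_sub_distrib]
    rfl
  have hint : ∀ i, Integrable (fun z : E d × E m => ((EuclideanSpace.proj i : E d →L[ℝ] ℝ).comp
        (fderiv ℝ (sF Ω z.2) z.1 - fderiv ℝ (sF Ω₀ z.2) z.1)) (EuclideanSpace.single i 1) +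
        (sF Ω z.2 z.1 - sF Ω₀ z.2 z.1) i * (P.fisherScore z.2 z.1 + P.priorScore z.1) i)
        P.jointLaw :=
    fun i => (integrable_fisherNet_jacobian_sub hP hregF hlip hΩ hΩ₀ i).add
      (integrable_coord_mul hh2 hs2 i i)
  simp only [e]
  refine ⟨integrable_finsetSum _ fun i _ => hint i, ?_⟩
  rw [integral_finsetSum _ fun i _ => hint i]
  refine Finset.sum_eq_zero fun i _ => ?_
  refine integral_jointLaw_stein hP hregF (f := fun x θ => (sF Ω x θ - sF Ω₀ x θ) i)
    (f' := fun x θ => (EuclideanSpace.proj i : E d →L[ℝ] ℝ).comp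
      (fderiv ℝ (sF Ω x) θ - fderiv ℝ (sF Ω₀ x) θ)) ?_ ?_ i (hint i)
  · intro x θ hθ hx
    have hpos := mul_pos hx (prior_pos hP hθ)
    exact (EuclideanSpace.proj i : E d →L[ℝ] ℝ).hasFDerivAt.comp θ
      ((hregF.net_differentiable Ω hΩ x θ hθ hpos).hasFDerivAt.sub
      (hregF.net_differentiable Ω₀ hΩ₀ x θ hθ hpos).hasFDerivAt)
  · intro x
    have := ((hregF.boundary Ω hΩ x).coord i).sub ((hregF.boundary Ω₀ hΩ₀ x).coord i)
    simpa [mul_sub] using this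

end Model

/-- Excess score matching objective of the prior network with parameter `Ω` over the one with
parameter `Ω₀`, at a single data point. Unlike the objective itself it is integrable, since the
difference of the Jacobians is dominated by the Lipschitz condition. -/
def priorExcess (s : E kP → E d → E d) (Ω₀ Ω : E kP) (θ : E d) : ℝ :=
  ‖s Ω θ‖ ^ 2 - ‖s Ω₀ θ‖ ^ 2 + 2 * (opTrace (fderiv ℝ (s Ω) θ) - opTrace (fderiv ℝ (s Ω₀) θ))

/-- Excess Fisher score matching objective of the network with parameter `p.1` over the one with
parameter `Ω₀`, at a single data point, when `p.2` is the parameter of the prior network in use. -/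
def fisherExcess (s : E kF → E m → E d → E d) (sP : E kP → E d → E d) (Ω₀ : E kF)
    (p : E kF × E kP) (z : E d × E m) : ℝ :=
  ‖s p.1 z.2 z.1‖ ^ 2 - ‖s Ω₀ z.2 z.1‖ ^ 2
    + 2 * (opTrace (fderiv ℝ (s p.1 z.2) z.1) - opTrace (fderiv ℝ (s Ω₀ z.2) z.1))
    + 2 * inner ℝ (s p.1 z.2 z.1 - s Ω₀ z.2 z.1) (sP p.2 z.1)

namespace Model

variable {P : Model d m}
variable {SP : Set (E kP)} {SF : Set (E kF)} {sP : E kP → E d → E d} {sF : E kF → E m → E d → E d}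

lemma sq_norm_sub_sq_norm_eq (u v : E d) :
    ‖u‖ ^ 2 - ‖v‖ ^ 2 = ‖u - v‖ ^ 2 + 2 * inner ℝ (u - v) v := by
  rw [norm_sub_sq_real, inner_sub_left, real_inner_self_eq_norm_sq]; ring

lemma sq_norm_le_young (u v : E d) :
    ‖u‖ ^ 2 ≤ 2 * (‖u‖ ^ 2 + 2 * inner ℝ u v) + 4 * ‖v‖ ^ 2 := by
  have h : 0 ≤ ‖u + (2 : ℝ) • v‖ ^ 2 := by positivity
  rw [norm_add_sq_real, inner_smul_right, norm_smul, Real.norm_ofNat, mul_pow] at h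
  linarith

/-- If `q` has the mean of `‖u‖² + 2⟪u, v⟫`, then `E q` controls `E ‖u‖²` up to `E ‖v‖²`. -/
lemma integral_sq_norm_le_of_ae_eq {𝒵 : Type*} [MeasurableSpace 𝒵] {ρ : Measure 𝒵} {u v : 𝒵 → E d}
    {T q : 𝒵 → ℝ} (hu : MemLp u 2 ρ) (hv : MemLp v 2 ρ) (hT : Integrable T ρ)
    (hT0 : ∫ z, T z ∂ρ = 0)
    (hq : q =ᵐ[ρ] fun z => (‖u z‖ ^ 2 + 2 * inner ℝ (u z) (v z)) + 2 * T z) :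
    Integrable q ρ ∧ ∫ z, ‖u z‖ ^ 2 ∂ρ ≤ 2 * ∫ z, q z ∂ρ + 4 * ∫ z, ‖v z‖ ^ 2 ∂ρ := by
  have hu' : Integrable (fun z => ‖u z‖ ^ 2) ρ := hu.integrable_norm_pow two_ne_zero
  have hv' : Integrable (fun z => ‖v z‖ ^ 2) ρ := hv.integrable_norm_pow two_ne_zero
  have hA : Integrable (fun z => ‖u z‖ ^ 2 + 2 * inner ℝ (u z) (v z)) ρ :=
    hu'.add ((integrable_inner hu hv).const_mul 2)
  refine ⟨(hA.add (hT.const_mul 2)).congr hq.symm, ?_⟩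
  rw [integral_congr_ae hq, integral_add hA (hT.const_mul 2), integral_const_mul 2 T, hT0,
    mul_zero, add_zero, ← integral_const_mul, ← integral_const_mul,
    ← integral_add (hA.const_mul 2) (hv'.const_mul 4)]
  exact integral_mono hu' ((hA.const_mul 2).add (hv'.const_mul 4)) fun z => sq_norm_le_young _ _

/-- The expected excess objective of the prior network is the mean square distance to the score. -/
theorem integral_priorExcess (hP : BCRBRegular P) (hregP : PriorMatchingRegular P SP sP)
    (hlip : LipschitzInParam P.priorLaw SP sP (fun Ω θ => fderiv ℝ (sP Ω) θ))
    (hp2 : MemLp P.priorScore 2 P.priorLaw)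
    {Ω Ω₀ : E kP} (hΩ : Ω ∈ SP) (hΩ₀ : Ω₀ ∈ SP)
    (hreal : ∀ θ ∈ interior P.paramSet, 0 < P.prior θ → sP Ω₀ θ = P.priorScore θ) :
    Integrable (priorExcess sP Ω₀ Ω) P.priorLaw ∧
    ∫ θ, priorExcess sP Ω₀ Ω θ ∂P.priorLaw = ∫ θ, ‖sP Ω θ - P.priorScore θ‖ ^ 2 ∂P.priorLaw := by
  obtain ⟨h1, h2⟩ := integral_priorNet_stein hP hregP hlip hp2 hΩ hΩ₀
  have hsq : Integrable (fun θ => ‖sP Ω θ - P.priorScore θ‖ ^ 2) P.priorLaw :=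
    ((priorNet_memLp hregP hΩ).sub hp2).integrable_norm_pow two_ne_zero
  have hae : priorExcess sP Ω₀ Ω =ᵐ[P.priorLaw] fun θ => ‖sP Ω θ - P.priorScore θ‖ ^ 2 +
      2 * (opTrace (fderiv ℝ (sP Ω) θ) - opTrace (fderiv ℝ (sP Ω₀) θ) +
      inner ℝ (sP Ω θ - sP Ω₀ θ) (P.priorScore θ)) := by
    filter_upwards [ae_priorLaw_interior hP] with θ hθ
    rw [priorExcess, sq_norm_sub_sq_norm_eq, hreal θ hθ (prior_pos hP hθ)]
    ring
  refine ⟨(hsq.add (h1.const_mul 2)).congr hae.symm, ?_⟩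
  rw [integral_congr_ae hae, integral_add hsq (h1.const_mul 2), integral_const_mul, h2]
  ring

/-- The expected excess objective of the Fisher network controls the mean square distance to the
score, up to the error of the prior network in use. -/
theorem le_integral_fisherExcess (hP : BCRBRegular P) (hregP : PriorMatchingRegular P SP sP)
    (hregF : FisherMatchingRegular P SF sF)
    (hlip : LipschitzInParam P.jointLaw SF (fun Ω z => sF Ω z.2 z.1)
      (fun Ω z => fderiv ℝ (sF Ω z.2) z.1))
    (hp2 : MemLp P.priorScore 2 P.priorLaw)
    (hf2 : MemLp (fun z : E d × E m => P.fisherScore z.2 z.1) 2 P.jointLaw)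
    {Ω Ω₀ : E kF} (hΩ : Ω ∈ SF) (hΩ₀ : Ω₀ ∈ SF)
    (hreal : ∀ x, ∀ θ ∈ interior P.paramSet, 0 < P.joint x θ → sF Ω₀ x θ = P.fisherScore x θ)
    {ΩP : E kP} (hΩP : ΩP ∈ SP) :
    Integrable (fisherExcess sF sP Ω₀ (Ω, ΩP)) P.jointLaw ∧
    ∫ z, ‖sF Ω z.2 z.1 - P.fisherScore z.2 z.1‖ ^ 2 ∂P.jointLaw ≤
      2 * ∫ z, fisherExcess sF sP Ω₀ (Ω, ΩP) z ∂P.jointLaw +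
      4 * ∫ θ, ‖sP ΩP θ - P.priorScore θ‖ ^ 2 ∂P.priorLaw := by
  obtain ⟨h1, h2⟩ := integral_fisherNet_stein hP hregF hlip hp2 hf2 hΩ hΩ₀
  have hu : MemLp (fun z : E d × E m => sF Ω z.2 z.1 - P.fisherScore z.2 z.1) 2 P.jointLaw :=
    (fisherNet_memLp hregF hΩ).sub hf2
  have hv : MemLp (fun z : E d × E m => sP ΩP z.1 - P.priorScore z.1) 2 P.jointLaw :=
    (memLp_comp_fst (priorNet_memLp hregP hΩP)).sub (memLp_comp_fst hp2)
  have hmap : ∫ θ, ‖sP ΩP θ - P.priorScore θ‖ ^ 2 ∂P.priorLaw =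
      ∫ z : E d × E m, ‖sP ΩP z.1 - P.priorScore z.1‖ ^ 2 ∂P.jointLaw := by
    have hm : AEStronglyMeasurable (fun θ => ‖sP ΩP θ - P.priorScore θ‖ ^ 2) P.priorLaw :=
      (((priorNet_memLp hregP hΩP).sub hp2).integrable_norm_pow two_ne_zero).aestronglyMeasurable
    rw [← map_fst_jointLaw] at hm ⊢
    exact integral_map measurable_fst.aemeasurable hm
  rw [hmap]
  refine integral_sq_norm_le_of_ae_eq hu hv h1 h2 ?_
  filter_upwards [ae_jointLaw_interior hP] with z hz
  dsimp only [fisherExcess]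
  rw [sq_norm_sub_sq_norm_eq, hreal z.2 z.1 hz.1 (mul_pos hz.2 (prior_pos hP hz.1)),
    inner_add_right, inner_sub_right (sF Ω z.2 z.1 - P.fisherScore z.2 z.1)]
  ring

/-- The excess objective of the Fisher network is Lipschitz in the parameters of both networks. -/
lemma fisherExcess_lipschitz (hregP : PriorMatchingRegular P SP sP)
    (hlipP : LipschitzInParam P.priorLaw SP sP (fun Ω θ => fderiv ℝ (sP Ω) θ))
    (hlip : LipschitzInParam P.jointLaw SF (fun Ω z => sF Ω z.2 z.1)
      (fun Ω z => fderiv ℝ (sF Ω z.2) z.1)) (hSP : IsCompact SP) (hSF : IsCompact SF)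
    {Ω₀ : E kF} (hΩ₀ : Ω₀ ∈ SF) {Ω₁ : E kP} (hΩ₁ : Ω₁ ∈ SP) :
    ∃ L : E d × E m → ℝ, Integrable L P.jointLaw ∧ ∀ᵐ z ∂P.jointLaw, ∀ p ∈ SF ×ˢ SP,
      ∀ q ∈ SF ×ˢ SP, |fisherExcess sF sP Ω₀ p z - fisherExcess sF sP Ω₀ q z| ≤ L z * dist p q := by
  obtain ⟨A, hA, hA'⟩ := hlip.objective
  obtain ⟨B, hB, hB0, hB'⟩ := hlip.net
  obtain ⟨C, hC, hC0, hC'⟩ := hlipP.net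
  obtain ⟨DP, hDP⟩ := Metric.isBounded_iff.1 hSP.isBounded
  obtain ⟨DF, hDF⟩ := Metric.isBounded_iff.1 hSF.isBounded
  have hDP0 : 0 ≤ DP := dist_nonneg.trans (hDP hΩ₁ hΩ₁)
  have hDF0 : 0 ≤ DF := dist_nonneg.trans (hDF hΩ₀ hΩ₀)
  have hC2 : MemLp (fun z : E d × E m => C z.1) 2 P.jointLaw := by
    rw [← map_fst_jointLaw] at hC
    exact hC.comp_of_map measurable_fst.aemeasurable
  have hs2 : MemLp (fun z : E d × E m => ‖sP Ω₁ z.1‖) 2 P.jointLaw :=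
    (memLp_comp_fst (priorNet_memLp hregP hΩ₁)).norm
  have hC'' : ∀ᵐ z ∂P.jointLaw, ∀ a ∈ SP, ∀ b ∈ SP,
      ‖sP a z.1 - sP b z.1‖ ≤ C z.1 * dist a b := by
    rw [← map_fst_jointLaw] at hC'
    exact ae_of_ae_map measurable_fst.aemeasurable hC'
  refine ⟨fun z => |A z| + 2 * (B z * ‖sP Ω₁ z.1‖ + (DP + DF) * (B z * C z.1)),
    hA.abs.add (((hB.integrable_mul hs2).add
      ((hB.integrable_mul hC2).const_mul _)).const_mul 2), ?_⟩
  filter_upwards [hA', hB', hC''] with z hA' hB' hC'' p hp q hq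
  have d1 : dist p.1 q.1 ≤ dist p q := le_max_left _ _
  have d2 : dist p.2 q.2 ≤ dist p q := le_max_right _ _
  have a0 := hA' p.1 hp.1 q.1 hq.1
  have b1 := hB' p.1 hp.1 q.1 hq.1
  have b2 := hB' q.1 hq.1 Ω₀ hΩ₀
  have c1 := hC'' p.2 hp.2 q.2 hq.2
  have c2 := hC'' p.2 hp.2 Ω₁ hΩ₁
  have hb0 := hB0 z
  have hc0 := hC0 z.1
  have b2' : ‖sF q.1 z.2 z.1 - sF Ω₀ z.2 z.1‖ ≤ B z * DF :=
    b2.trans (mul_le_mul_of_nonneg_left (hDF hq.1 hΩ₀) hb0)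
  have c2' : ‖sP p.2 z.1‖ ≤ ‖sP Ω₁ z.1‖ + C z.1 * DP := by
    have := norm_le_insert' (sP p.2 z.1) (sP Ω₁ z.1)
    have h := c2.trans (mul_le_mul_of_nonneg_left (hDP hp.2 hΩ₁) hc0)
    linarith
  have i1 : |inner ℝ (sF p.1 z.2 z.1 - sF q.1 z.2 z.1) (sP p.2 z.1)| ≤
      (B z * dist p.1 q.1) * (‖sP Ω₁ z.1‖ + C z.1 * DP) :=
    (abs_real_inner_le_norm _ _).trans (mul_le_mul b1 c2' (norm_nonneg _)
      (mul_nonneg hb0 dist_nonneg))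
  have i2 : |inner ℝ (sF q.1 z.2 z.1 - sF Ω₀ z.2 z.1) (sP p.2 z.1 - sP q.2 z.1)| ≤
      (B z * DF) * (C z.1 * dist p.2 q.2) :=
    (abs_real_inner_le_norm _ _).trans (mul_le_mul b2' c1 (norm_nonneg _)
      (mul_nonneg hb0 hDF0))
  have e : fisherExcess sF sP Ω₀ p z - fisherExcess sF sP Ω₀ q z =
      (‖sF p.1 z.2 z.1‖ ^ 2 - ‖sF q.1 z.2 z.1‖ ^ 2 + 2 * (opTrace (fderiv ℝ (sF p.1 z.2) z.1) -
        opTrace (fderiv ℝ (sF q.1 z.2) z.1)))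
      + 2 * inner ℝ (sF p.1 z.2 z.1 - sF q.1 z.2 z.1) (sP p.2 z.1)
      + 2 * inner ℝ (sF q.1 z.2 z.1 - sF Ω₀ z.2 z.1) (sP p.2 z.1 - sP q.2 z.1) := by
    simp only [fisherExcess, inner_sub_left, inner_sub_right]; ring
  rw [e]
  refine (abs_add_three _ _ _).trans ?_
  rw [abs_mul, abs_mul, abs_two]
  refine (add_le_add_three a0 (mul_le_mul_of_nonneg_left i1 zero_le_two)
    (mul_le_mul_of_nonneg_left i2 zero_le_two)).trans ?_
  have A0 : A z * dist p.1 q.1 ≤ |A z| * dist p q :=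
    mul_le_mul (le_abs_self _) d1 dist_nonneg (abs_nonneg _)
  have A1 : (B z * dist p.1 q.1) * (‖sP Ω₁ z.1‖ + C z.1 * DP) ≤
      (B z * dist p q) * (‖sP Ω₁ z.1‖ + C z.1 * DP) := by gcongr
  have A2 : (B z * DF) * (C z.1 * dist p.2 q.2) ≤ (B z * DF) * (C z.1 * dist p q) := by gcongr
  calc _ ≤ |A z| * dist p q + 2 * ((B z * dist p q) * (‖sP Ω₁ z.1‖ + C z.1 * DP))
        + 2 * ((B z * DF) * (C z.1 * dist p q)) := by linarith
    _ = _ := by ring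

end Model

/-! ### Strong consistency of the learned information -/

section Consistency

variable {P : Model d m}
variable {SP : Set (E kP)} {SF : Set (E kF)} {sP : E kP → E d → E d} {sF : E kF → E m → E d → E d}
variable {Ωs : Type*} [MeasurableSpace Ωs] {μ : Measure Ωs} {J : ℕ}
  {θ : ℕ → Ωs → E d} {X : ℕ → Fin J → Ωs → E m}

lemma IsData.iIndepFun_pair (h : IsData μ P J θ X) (j : Fin J) :
    iIndepFun (fun n ω => (θ n ω, X n j ω)) μ :=
  h.indep.comp (fun _ z => (z.1, z.2 j)) fun _ => Model.measurable_pair J j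

lemma IsData.map_pair (h : IsData μ P J θ X) (j : Fin J) (n : ℕ) :
    μ.map (fun ω => (θ n ω, X n j ω)) = P.jointLaw := by
  have hm : Measurable (fun ω => (θ n ω, fun j => X n j ω)) :=
    (h.measurable_θ n).prodMk (measurable_pi_lambda _ fun j => h.measurable_X n j)
  rw [← Model.map_pair_setLaw J j, ← h.law n, Measure.map_map (Model.measurable_pair J j) hm]
  rfl

lemma IsData.iIndepFun_param (h : IsData μ P J θ X) : iIndepFun θ μ :=
  h.indep.comp (fun _ z => z.1) fun _ => measurable_fst

lemma IsData.map_param (h : IsData μ P J θ X) (hJ : 1 ≤ J) (n : ℕ) :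
    μ.map (θ n) = P.priorLaw := by
  rw [← Model.map_fst_jointLaw, ← h.map_pair ⟨0, hJ⟩ n, Measure.map_map measurable_fst
    ((h.measurable_θ n).prodMk (h.measurable_X n _))]
  rfl

lemma mean_priorExcess_nonpos {n : ℕ} {t : ℕ → E d} {Ω₀ Ω : E kP} (hΩ₀ : Ω₀ ∈ SP)
    (hmin : IsMinOn (priorLoss sP n t) SP Ω) :
    (1 / (n : ℝ)) * ∑ k ∈ Finset.range n, priorExcess sP Ω₀ Ω (t k) ≤ 0 := by
  have h : priorLoss sP n t Ω ≤ priorLoss sP n t Ω₀ := hmin hΩ₀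
  have e : (1 / (n : ℝ)) * ∑ k ∈ Finset.range n, priorExcess sP Ω₀ Ω (t k) =
      priorLoss sP n t Ω - priorLoss sP n t Ω₀ := by
    rw [priorLoss, priorLoss, ← mul_sub, ← Finset.sum_sub_distrib]
    congr 1
    refine Finset.sum_congr rfl fun k _ => ?_
    rw [priorExcess, traceJacobian_eq, traceJacobian_eq]; ring
  rw [e]; linarith

lemma mean_fisherExcess_nonpos {n : ℕ} {t : ℕ → E d} {x : ℕ → Fin J → E m} {Ω₀ Ω : E kF}
    {ΩP : E kP} (hΩ₀ : Ω₀ ∈ SF) (hmin : IsMinOn (fisherLoss sF (sP ΩP) n t x) SF Ω) :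
    (1 / (J : ℝ)) * ∑ j : Fin J, (1 / (n : ℝ)) * ∑ k ∈ Finset.range n,
      fisherExcess sF sP Ω₀ (Ω, ΩP) (t k, x k j) ≤ 0 := by
  have h : fisherLoss sF (sP ΩP) n t x Ω ≤ fisherLoss sF (sP ΩP) n t x Ω₀ := hmin hΩ₀
  have e : (1 / (J : ℝ)) * ∑ j : Fin J, (1 / (n : ℝ)) * ∑ k ∈ Finset.range n,
      fisherExcess sF sP Ω₀ (Ω, ΩP) (t k, x k j) =
      fisherLoss sF (sP ΩP) n t x Ω - fisherLoss sF (sP ΩP) n t x Ω₀ := by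
    rw [fisherLoss, fisherLoss, ← mul_sub, ← Finset.sum_sub_distrib, ← Finset.mul_sum,
      Finset.sum_comm, ← mul_assoc]
    congr 1
    · rw [one_div_mul_one_div, mul_comm]
    · refine Finset.sum_congr rfl fun k _ => ?_
      rw [← Finset.sum_sub_distrib]
      refine Finset.sum_congr rfl fun j _ => ?_
      simp only [fisherExcess, traceJacobian_eq, inner_sub_left]; ring
  rw [e]; linarith

/-- Consistency of the learned prior score and of the learned prior information. -/
theorem ae_tendsto_prior (hP : BCRBRegular P) (hSP : IsCompact SP)
    (hregP : PriorMatchingRegular P SP sP)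
    (hlipP : LipschitzInParam P.priorLaw SP sP (fun Ω θ => fderiv ℝ (sP Ω) θ))
    (hrealP : PriorRealizable P SP sP) (hJ : 1 ≤ J) (hdata : IsData μ P J θ X) :
    ∀ᵐ ω ∂μ, ∀ a : ℕ → E kP,
      (∀ n, 1 ≤ n → a n ∈ SP ∧ IsMinOn (priorLoss sP n (fun k => θ k ω)) SP (a n)) →
      Tendsto (fun n => ∫ t, ‖sP (a n) t - P.priorScore t‖ ^ 2 ∂P.priorLaw) atTop (𝓝 0) ∧
      Tendsto (fun n => learnedPriorFIM (sP (a n)) n (fun k => θ k ω)) atTop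
        (𝓝 (secondMoment P.priorLaw P.priorScore)) := by
  have hp2 := Model.priorScore_memLp hP hregP hrealP
  obtain ⟨Ω₀, hΩ₀, hreal⟩ := hrealP
  obtain ⟨L, hL, hL'⟩ := hlipP.objective
  obtain ⟨L₂, hL₂, hL₂'⟩ := hlipP.outer
  have hq : ∀ Ω ∈ SP, _ := fun Ω hΩ => Model.integral_priorExcess hP hregP hlipP hp2 hΩ hΩ₀ hreal
  have u1 := tendsto_empiricalMean_uniform hdata.measurable_θ hdata.iIndepFun_param
    (hdata.map_param hJ) hSP (g := priorExcess sP Ω₀) (fun Ω hΩ => (hq Ω hΩ).1) hL (by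
      filter_upwards [hL'] with t ht a ha b hb
      refine le_trans (le_of_eq ?_) (ht a ha b hb)
      congr 1
      simp only [priorExcess]; ring)
  have u2 := fun i j : Fin d =>
    tendsto_empiricalMean_uniform hdata.measurable_θ hdata.iIndepFun_param
      (hdata.map_param hJ) hSP (g := fun Ω t => outer (sP Ω t) i j)
      (fun Ω hΩ => integrable_coord_mul (Model.priorNet_memLp hregP hΩ)
        (Model.priorNet_memLp hregP hΩ) i j) hL₂ (by
      filter_upwards [hL₂'] with t ht a ha b hb
      exact ht a ha b hb i j)
  filter_upwards [u1, ae_all_iff.2 fun i => ae_all_iff.2 fun j => u2 i j] with ω h1 h2 a ha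
  have haS : ∀ n, 1 ≤ n → a n ∈ SP := fun n hn => (ha n hn).1
  have hV : Tendsto (fun n => ∫ t, ‖sP (a n) t - P.priorScore t‖ ^ 2 ∂P.priorLaw) atTop (𝓝 0) := by
    have h3 := (h1 a haS).neg
    rw [neg_zero] at h3
    refine squeeze_zero' (Eventually.of_forall fun n => integral_nonneg fun t => by positivity)
      ?_ h3
    filter_upwards [eventually_ge_atTop 1] with n hn
    have h4 := mean_priorExcess_nonpos hΩ₀ (ha n hn).2
    rw [(hq (a n) (haS n hn)).2]
    linarith
  refine ⟨hV, ?_⟩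
  have h5 := tendsto_secondMoment (fun n hn => Model.priorNet_memLp hregP (haS n hn)) hp2 hV
  refine tendsto_pi_nhds.2 fun i => tendsto_pi_nhds.2 fun j => ?_
  have h6 := (h2 i j a haS).add (h5 i j)
  rw [zero_add] at h6
  refine h6.congr fun n => ?_
  rw [sub_add_cancel, learnedPriorFIM, Matrix.smul_apply, Matrix.sum_apply, smul_eq_mul]

/-- Consistency of the learned measurement information, given a mean square consistent prior
score. -/
theorem ae_tendsto_fisher (hP : BCRBRegular P) (hSP : IsCompact SP) (hSF : IsCompact SF)
    (hregP : PriorMatchingRegular P SP sP) (hregF : FisherMatchingRegular P SF sF)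
    (hlipP : LipschitzInParam P.priorLaw SP sP (fun Ω θ => fderiv ℝ (sP Ω) θ))
    (hlipF : LipschitzInParam P.jointLaw SF (fun Ω z => sF Ω z.2 z.1)
      (fun Ω z => fderiv ℝ (sF Ω z.2) z.1))
    (hrealP : PriorRealizable P SP sP) (hrealF : FisherRealizable P SF sF)
    (hJ : 1 ≤ J) (hdata : IsData μ P J θ X) :
    ∀ᵐ ω ∂μ, ∀ (a : ℕ → E kF) (b : ℕ → E kP),
      (∀ n, 1 ≤ n → a n ∈ SF ∧ IsMinOn (fisherLoss sF (sP (b n)) n (fun k => θ k ω)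
        (fun k j => X k j ω)) SF (a n)) → (∀ n, 1 ≤ n → b n ∈ SP) →
      Tendsto (fun n => ∫ t, ‖sP (b n) t - P.priorScore t‖ ^ 2 ∂P.priorLaw) atTop (𝓝 0) →
      Tendsto (fun n => learnedMeasurementFIM (sF (a n)) n (fun k => θ k ω)
        (fun k j => X k j ω)) atTop
        (𝓝 (secondMoment P.jointLaw (fun z => P.fisherScore z.2 z.1))) := by
  have hp2 := Model.priorScore_memLp hP hregP hrealP
  have hf2 := Model.fisherScore_memLp hP hregF hrealF
  obtain ⟨Ω₀, hΩ₀, hreal⟩ := hrealF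
  obtain ⟨Ω₁, hΩ₁, -⟩ := hrealP
  obtain ⟨L, hL, hL'⟩ := Model.fisherExcess_lipschitz hregP hlipP hlipF hSP hSF hΩ₀ hΩ₁
  obtain ⟨L₂, hL₂, hL₂'⟩ := hlipF.outer
  have hq : ∀ p ∈ SF ×ˢ SP, _ := fun p hp =>
    Model.le_integral_fisherExcess hP hregP hregF hlipF hp2 hf2 hp.1 hΩ₀ hreal hp.2
  have hJ0 : (0 : ℝ) < J := by exact_mod_cast hJ
  have hmeas : ∀ (j : Fin J) (k : ℕ), Measurable fun ω => (θ k ω, X k j ω) := fun j k =>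
    (hdata.measurable_θ k).prodMk (hdata.measurable_X k j)
  have u1 := fun j : Fin J =>
    tendsto_empiricalMean_uniform (hmeas j) (hdata.iIndepFun_pair j)
      (hdata.map_pair j) (hSF.prod hSP) (g := fisherExcess sF sP Ω₀)
      (fun p hp => (hq p hp).1) hL hL'
  have u2 := fun (j : Fin J) (i i' : Fin d) =>
    tendsto_empiricalMean_uniform (hmeas j) (hdata.iIndepFun_pair j)
      (hdata.map_pair j) hSF (g := fun Ω z => outer (sF Ω z.2 z.1) i i')
      (fun Ω hΩ => integrable_coord_mul (Model.fisherNet_memLp hregF hΩ)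
        (Model.fisherNet_memLp hregF hΩ) i i') hL₂ (by
      filter_upwards [hL₂'] with t ht a ha b hb
      exact ht a ha b hb i i')
  filter_upwards [ae_all_iff.2 u1,
    ae_all_iff.2 fun j => ae_all_iff.2 fun i => ae_all_iff.2 (u2 j i)]
    with ω h1 h2 a b ha hb hVP
  have haS : ∀ n, 1 ≤ n → a n ∈ SF := fun n hn => (ha n hn).1
  have hpS : ∀ n, 1 ≤ n → (a n, b n) ∈ SF ×ˢ SP := fun n hn => ⟨haS n hn, hb n hn⟩
  -- average over the observations sharing a parameter
  have havg : ∀ c : ℝ, (1 / (J : ℝ)) * ∑ _j : Fin J, c = c := fun c => by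
    simp only [Finset.sum_const, Finset.card_univ, Fintype.card_fin, nsmul_eq_mul]
    field_simp
  have hV : Tendsto (fun n => ∫ z : E d × E m, ‖sF (a n) z.2 z.1 - P.fisherScore z.2 z.1‖ ^ 2
      ∂P.jointLaw) atTop (𝓝 0) := by
    have h3 := ((tendsto_finsetSum Finset.univ fun j _ =>
      h1 j (fun n => (a n, b n)) hpS).const_mul (1 / (J : ℝ))).const_mul (-2)
    have h4 := h3.add (hVP.const_mul 4)
    simp only [Finset.sum_const_zero, mul_zero, add_zero] at h4
    refine squeeze_zero' (Eventually.of_forall fun n => integral_nonneg fun t => by positivity)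
      ?_ h4
    filter_upwards [eventually_ge_atTop 1] with n hn
    have h5 := mean_fisherExcess_nonpos hΩ₀ (ha n hn).2
    have h6 := (hq _ (hpS n hn)).2
    rw [Finset.sum_sub_distrib, mul_sub, havg]
    dsimp only at h6
    linarith
  have h5 := tendsto_secondMoment (fun n hn => Model.fisherNet_memLp hregF (haS n hn)) hf2 hV
  refine tendsto_pi_nhds.2 fun i => tendsto_pi_nhds.2 fun i' => ?_
  have h6 := ((tendsto_finsetSum Finset.univ fun j _ =>
    h2 j i i' a haS).const_mul (1 / (J : ℝ))).add (h5 i i')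
  simp only [Finset.sum_const_zero, mul_zero, zero_add] at h6
  refine h6.congr fun n => ?_
  rw [Finset.sum_sub_distrib, mul_sub, havg, sub_add_cancel, learnedMeasurementFIM,
    Matrix.smul_apply, Matrix.sum_apply, smul_eq_mul, ← Finset.mul_sum, Finset.sum_comm,
    ← mul_assoc, one_div_mul_one_div, mul_comm (J : ℝ)]
  congr 1
  exact Finset.sum_congr rfl fun k _ => (Matrix.sum_apply _ _ _ _).symm

end Consistency

lemma outer_posSemidef (v : E d) : (outer v).PosSemidef := by
  have := Matrix.posSemidef_vecMulVec_self_star (R := ℝ) (fun i => v i)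
  simpa [outer, Matrix.vecMulVec, Pi.star_def] using this

lemma learnedFIM_posSemidef {J : ℕ} (N : ℕ) (sP : E d → E d) (sF : E m → E d → E d) (n : ℕ)
    (θ : ℕ → E d) (x : ℕ → Fin J → E m) : (learnedFIM N sP sF n θ x).PosSemidef := by
  refine Matrix.PosSemidef.add (Matrix.PosSemidef.smul (Matrix.PosSemidef.smul ?_ (by positivity))
    (by positivity)) (Matrix.PosSemidef.smul ?_ (by positivity))
  · exact Matrix.posSemidef_sum _ fun k _ => Matrix.posSemidef_sum _ fun j _ => outer_posSemidef _
  · exact Matrix.posSemidef_sum _ fun k _ => outer_posSemidef _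

/-- Positive definiteness and inverses pass to the limit, among positive semidefinite matrices. -/
lemma eventually_posDef_and_tendsto_inv {A : ℕ → Matrix (Fin d) (Fin d) ℝ}
    {B : Matrix (Fin d) (Fin d) ℝ} (hA : ∀ n, (A n).PosSemidef) (hB : B.PosDef)
    (hlim : Tendsto A atTop (𝓝 B)) :
    (∀ᶠ n in atTop, (A n).PosDef) ∧ Tendsto (fun n => (A n)⁻¹) atTop (𝓝 B⁻¹) := by
  have hdet0 : B.det ≠ 0 := hB.det_pos.ne'
  have hdet : Tendsto (fun n => (A n).det) atTop (𝓝 B.det) :=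
    ((continuous_id.matrix_det).tendsto B).comp hlim
  have hadj : Tendsto (fun n => (A n).adjugate) atTop (𝓝 B.adjugate) :=
    ((continuous_id.matrix_adjugate).tendsto B).comp hlim
  constructor
  · filter_upwards [hdet.eventually_ne hdet0] with n hn
    exact (hA n).posDef_iff_det_ne_zero.2 hn
  · simp only [Matrix.inv_def, Ring.inverse_eq_inv']
    exact (hdet.inv₀ hdet0).smul hadj

end LBCRB

end

theorem mainTheorem11 {d m kP kF : ℕ} (P : LBCRB.Model d m) (hP : LBCRB.BCRBRegular P)
    -- parameter sets and networks for the prior score and the Fisher score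
    (SP : Set (LBCRB.E kP)) (SF : Set (LBCRB.E kF)) (hSP : IsCompact SP) (hSF : IsCompact SF)
    (sP : LBCRB.E kP → LBCRB.E d → LBCRB.E d)
    (sF : LBCRB.E kF → LBCRB.E m → LBCRB.E d → LBCRB.E d)
    (hregP : LBCRB.PriorMatchingRegular P SP sP) (hregF : LBCRB.FisherMatchingRegular P SF sF)
    (hlipP : LBCRB.LipschitzInParam P.priorLaw SP sP (fun Ω θ => fderiv ℝ (sP Ω) θ))
    (hlipF : LBCRB.LipschitzInParam P.jointLaw SF (fun Ω z => sF Ω z.2 z.1)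
      (fun Ω z => fderiv ℝ (sF Ω z.2) z.1))
    (hrealP : LBCRB.PriorRealizable P SP sP) (hrealF : LBCRB.FisherRealizable P SF sF)
    -- random data, with `J` observations per parameter
    {Ωs : Type*} [MeasurableSpace Ωs] (μ : Measure Ωs) [IsProbabilityMeasure μ]
    (J : ℕ) (hJ : 1 ≤ J) (θ : ℕ → Ωs → LBCRB.E d) (X : ℕ → Fin J → Ωs → LBCRB.E m)
    (hdata : LBCRB.IsData μ P J θ X)
    -- global minimizers of the empirical objectives on the first `n` data points
    (ΩP : ℕ → Ωs → LBCRB.E kP) (ΩF : ℕ → Ωs → LBCRB.E kF)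
    (hΩP : ∀ᵐ ω ∂μ, ∀ n, 1 ≤ n → ΩP n ω ∈ SP ∧
      IsMinOn (LBCRB.priorLoss sP n (fun k => θ k ω)) SP (ΩP n ω))
    (hΩF : ∀ᵐ ω ∂μ, ∀ n, 1 ≤ n → ΩF n ω ∈ SF ∧
      IsMinOn (LBCRB.fisherLoss sF (sP (ΩP n ω)) n (fun k => θ k ω) (fun k j => X k j ω))
        SF (ΩF n ω))
    -- bounds on the learned scores over the data set, of smaller order than `n`
    (cM cP : ℕ → Ωs → ℝ)
    (hcM : ∀ᵐ ω ∂μ, ∀ n, ∀ k < n, LBCRB.specNorm ((1 / (J : ℝ)) •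
      ∑ j, LBCRB.outer (sF (ΩF n ω) (X k j ω) (θ k ω))) ≤ cM n ω)
    (hcP : ∀ᵐ ω ∂μ, ∀ n, ∀ k < n, ‖sP (ΩP n ω) (θ k ω)‖ ^ 2 ≤ cP n ω)
    (hcM_lim : ∀ᵐ ω ∂μ, Tendsto (fun n : ℕ => cM n ω / n) atTop (𝓝 0))
    (hcP_lim : ∀ᵐ ω ∂μ, Tendsto (fun n : ℕ => cP n ω / n) atTop (𝓝 0))
    -- number of observations for which the bound is computed
    (N : ℕ) (hN : 1 ≤ N) :
    Integrable (fun z => ‖P.bayesScore N z.2 z.1‖ ^ 2) (P.setLaw N) ∧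
    (P.bayesFIM N).PosDef ∧
    ∀ᵐ ω ∂μ,
      (∀ᶠ n : ℕ in atTop, (LBCRB.learnedFIM N (sP (ΩP n ω)) (sF (ΩF n ω)) n (fun k => θ k ω)
        (fun k j => X k j ω)).PosDef) ∧
      Tendsto (fun n : ℕ => (LBCRB.learnedFIM N (sP (ΩP n ω)) (sF (ΩF n ω)) n (fun k => θ k ω)
        (fun k j => X k j ω))⁻¹) atTop (𝓝 (P.bayesFIM N)⁻¹) := by
  have hp2 := LBCRB.Model.priorScore_memLp hP hregP hrealP
  have hf2 := LBCRB.Model.fisherScore_memLp hP hregF hrealF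
  have hpd := LBCRB.Model.bayesFIM_posDef hP hregF hp2 hf2 hN
  refine ⟨(LBCRB.Model.bayesScore_memLp hP hregF hp2 hf2 hN).integrable_norm_pow two_ne_zero,
    hpd, ?_⟩
  filter_upwards [LBCRB.ae_tendsto_prior hP hSP hregP hlipP hrealP hJ hdata,
    LBCRB.ae_tendsto_fisher hP hSP hSF hregP hregF hlipP hlipF hrealP hrealF hJ hdata, hΩP, hΩF]
    with ω h1 h2 h3 h4
  obtain ⟨hV, hFP⟩ := h1 (fun n => ΩP n ω) h3
  have hFM := h2 (fun n => ΩF n ω) (fun n => ΩP n ω) h4 (fun n hn => (h3 n hn).1) hV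
  refine LBCRB.eventually_posDef_and_tendsto_inv
    (fun n => LBCRB.learnedFIM_posSemidef N _ _ n _ _) hpd ?_
  rw [LBCRB.Model.bayesFIM_eq hP hregF hp2 hf2 hN]
  exact (hFM.const_smul (N : ℝ)).add hFP
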